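/- **Theorem 2.1.** Let $k$ be an algebraically closed field, let $X$ be a scheme locally of finite type over $k$, and let $x\in X$ be a smooth point at which $X$ is a surface, i.e. a closed point whose local ring $\mathcal O_{X,x}$ is regular of dimension $2$, with maximal ideal $m_x$. A cluster $\zeta$ supported at $x$ is a closed subscheme of $X$ whose support is $\{x\}$; $I_\zeta\subset\mathcal O_{X,x}$ denotes the stalk at $x$ of its ideal sheaf, and $\deg\zeta=\dim_k H^0(\mathcal O_\zeta)$ its degree (length). Then: 1. A cluster $\zeta$ supported at $x$ is Gorenstein if and only if it is a complete intersection, i.e. $I_\zeta$ is generated by two elements. 2. For every integer $n\ge 0$, the maximum $$l_n=\max\{\deg\zeta : \zeta \text{ is a Gorenstein cluster supported at } x \text{ with } m_x^{n+1}\subset I_\zeta\}$$ exists and equals $\left\lfloor \frac{(n+2)^2}{4}\right\rfloor$. 3. Let $z_1,z_2$ be local parameters at $x$, i.e. $m_x=(z_1,z_2)$. If $n=2m$ with $m\ge 0$, put $J=(z_1^{m+1},z_2^{m+1})$; if $n=2m-1$ with $m\ge 1$, put $J=(z_1^{m},z_2^{m+1})$. Then there is a cluster $\zeta$ supported at $x$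 with $I_\zeta=J$, and every such cluster is Gorenstein, satisfies $m_x^{n+1}\subset I_\zeta$, and has degree $\left\lfloor \frac{(n+2)^2}{4}\right\rfloor$. -/

import Mathlib

open CategoryTheory AlgebraicGeometry IsLocalRing

universe u

/-- A Gorenstein local ring: a Noetherian local ring of finite injective dimension
as a module over itself. -/
structure IsGorensteinLocalRing (R : Type u) [CommRing R] : Prop where
  isLocalRing : IsLocalRing R
  isNoetherianRing : IsNoetherianRing R
  exists_hasInjectiveDimensionLE : ∃ d : ℕ, HasInjectiveDimensionLE (ModuleCat.of R R) d

/-- A scheme is Gorenstein if all its local rings are Gorenstein. -/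
def IsGorensteinScheme (Z : Scheme.{u}) : Prop :=
  ∀ z : Z, IsGorensteinLocalRing (Z.presheaf.stalk z)

/-- `x` is a smooth point of the surface `X`, for `X` locally of finite type over an algebraically
closed field: `x` is a closed point at which the local ring is regular of dimension two.
(Over an algebraically closed field this is the same as smoothness of the structure morphism,
of relative dimension two, at the closed point `x`.) Nothing is required of `X` away
from `x`, where it may be singular, reducible or non-reduced. -/
structure IsSmoothSurfacePoint (X : Scheme.{u}) (x : X) : Prop where
  isClosed : IsClosed ({x} : Set X)
  isRegularLocalRing : IsRegularLocalRing (X.presheaf.stalk x)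
  ringKrullDim_eq : ringKrullDim (X.presheaf.stalk x) = 2

/-- A cluster (zero-dimensional closed subscheme) of `X` supported at the point `x`, given by its
quasi-coherent ideal sheaf. -/
structure ClusterAt (X : Scheme.{u}) (x : X) where
  /-- The ideal sheaf of the cluster. -/
  idealSheaf : X.IdealSheafData
  support_eq : (idealSheaf.support : Set X) = {x}

namespace ClusterAt

variable {X : Scheme.{u}} {x : X} (ζ : ClusterAt X x)

/-- The cluster as a scheme. -/
noncomputable def toScheme : Scheme.{u} := ζ.idealSheaf.subscheme

/-- The closed immersion of the cluster into `X`. -/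
noncomputable def ι : ζ.toScheme ⟶ X := ζ.idealSheaf.subschemeι

/-- The stalk at `x` of the ideal sheaf of the cluster, an ideal of the local ring of `X` at `x`:
it is generated by the germs of the sections of the ideal sheaf over affine open
neighbourhoods of `x`. -/
noncomputable def ideal : Ideal (X.presheaf.stalk x) :=
  ⨆ (U : X.affineOpens) (hx : x ∈ U.1),
    (ζ.idealSheaf.ideal U).map (X.presheaf.germ U.1 x hx).hom

/-- The cluster is a Gorenstein scheme. -/
def IsGorenstein : Prop := IsGorensteinScheme ζ.toScheme

/-- The cluster is a (local) complete intersection on a surface: its ideal in the local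
ring at `x` is generated by two elements. -/
def IsCompleteIntersection : Prop :=
  ∃ f g : X.presheaf.stalk x, ζ.ideal = Ideal.span {f, g}

/-- The degree (length) of the cluster over the base field `k`:
the dimension over `k` of its ring of global functions. -/
noncomputable def degree {k : Type u} [Field k] (p : X ⟶ Spec (.of k)) : ℕ :=
  letI : Algebra k Γ(ζ.toScheme, ⊤) :=
    ((Scheme.ΓSpecIso (.of k)).inv ≫ (ζ.ι ≫ p).appTop).hom.toAlgebra
  Module.finrank k Γ(ζ.toScheme, ⊤)

end ClusterAt

/-! Let R be the local ring at x and m its maximal ideal. The global functions on a cluster form A =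
R/I, a finite-dimensional local k-algebra with residue field k, so all three claims reduce to linear
algebra over k.

A is Gorenstein exactly when its socle is a line (`isGorensteinLocalRing_iff`). Embedding k in A
shows that finite injective dimension forces Ext¹(-, A) = 0 on finite modules; self-injectivity then
makes any two socle lines coincide. Conversely, a functional φ that is nonzero on a simple socle
makes φ(xy) a perfect pairing, so A is isomorphic to its dual and injective.

The Koszul relation between the parameters gives dim I/mI = dim soc(A) + 1
(`finite_and_finrank_quotient_maximalIdeal_mul`). By Nakayama, a simple socle therefore means two
generators.

For the bound, the perfect pairing gives dim A ≤ dim A/B + dim A/C whenever BC = 0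
(`HasLeastNonzeroIdeal.finrank_le`). This applies to the images of mⁱ and mʲ with i + j = n + 1,
where dim R/mⁱ ≤ i(i+1)/2; taking i and j as equal as possible yields ⌊(n+2)²/4⌋. The bound is
attained by (z₁ᵃ, z₂ᵇ) with a + b = n + 2 and a, b nearly equal: this ideal contains mⁿ⁺¹ and has
colength ab.

Regularity enters through m = (z₁, z₂) and dim R = 2, which make R a domain and (z₁) a prime ideal
not containing z₂. -/

theorem sup_pow_le_sup_pow {R : Type*} [CommRing R] (I J : Ideal R) (n : ℕ) :
    (I ⊔ J) ^ n ≤ I ⊔ J ^ n := by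
  induction n with
  | zero => simp
  | succ n ih =>
    rw [pow_succ, pow_succ]
    refine (Ideal.mul_mono_left ih).trans ?_
    rw [Ideal.sup_mul, Ideal.mul_sup (J ^ n)]
    exact sup_le (Ideal.mul_le_left.trans le_sup_left)
      (sup_le (Ideal.mul_le_right.trans le_sup_left) le_sup_right)

/-! ### Two-dimensional local rings with two parameters -/

section RegularLocal

variable {R : Type*} [CommRing R] [IsLocalRing R] [IsNoetherianRing R]

/-- If a power of `w₂` lies in the ideal generated by `w₁`, the dimension is at most one. -/
theorem ringKrullDim_le_one_of_pow_mem {w₁ w₂ : R} (hm : maximalIdeal R = Ideal.span {w₁, w₂})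
    {n : ℕ} (hn : w₂ ^ n ∈ Ideal.span {w₁}) : ringKrullDim R ≤ 1 := by
  rw [← IsLocalRing.maximalIdeal_height_eq_ringKrullDim]
  -- A prime containing w₁ contains w₂ too, so Krull's principal ideal theorem applies to m.
  have h : maximalIdeal R ∈ (Ideal.span {w₁}).minimalPrimes := by
    refine ⟨⟨inferInstance, ?_⟩, fun q ⟨hq, hle⟩ _ ↦ ?_⟩
    · rw [hm, Ideal.span_singleton_le_iff_mem]
      exact Ideal.subset_span (by simp)
    · have h₂ : w₂ ∈ q := hq.mem_of_pow_mem n (hle hn)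
      rw [hm, Ideal.span_le]
      rintro y (rfl | rfl)
      · exact hle (Ideal.mem_span_singleton_self _)
      · exact h₂
  exact_mod_cast Ideal.height_le_one_of_isPrincipal_of_mem_minimalPrimes _ _ h

/-- Modulo w₁ the maximal ideal is generated by w₂, and by Krull's intersection theorem a nonzero
element has a finite order n there. It is then a multiple of w₂ⁿ, and the cofactor is a unit by
maximality of n. -/
theorem exists_eq_unit_mul_pow_add {w₁ w₂ : R} (hm : maximalIdeal R = Ideal.span {w₁, w₂})
    {a : R} (ha : a ∉ Ideal.span {w₁}) :
    ∃ (n : ℕ) (v : R), IsUnit v ∧ a - v * w₂ ^ n ∈ Ideal.span {w₁} := by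
  have hI : Ideal.span {w₁} ≤ maximalIdeal R := by
    rw [hm, Ideal.span_singleton_le_iff_mem]
    exact Ideal.subset_span (by simp)
  have key : ∃ n, a ∉ Ideal.span {w₁} ⊔ maximalIdeal R ^ n := by
    by_contra! h
    have : Nontrivial (R ⧸ Ideal.span {w₁}) :=
      Ideal.Quotient.nontrivial_iff.mpr fun h ↦ (maximalIdeal.isMaximal R).ne_top (top_le_iff.mp (h ▸ hI))
    have : IsLocalRing (R ⧸ Ideal.span {w₁}) :=
      .of_surjective' (Ideal.Quotient.mk _) Ideal.Quotient.mk_surjective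
    have hbot := Ideal.iInf_pow_eq_bot_of_isLocalRing (maximalIdeal (R ⧸ Ideal.span {w₁}))
      (maximalIdeal.isMaximal _).ne_top
    have hmap : (maximalIdeal R).map (Ideal.Quotient.mk (Ideal.span {w₁})) ≤
        maximalIdeal (R ⧸ Ideal.span {w₁}) :=
      (((IsLocalRing.local_hom_TFAE (Ideal.Quotient.mk (Ideal.span {w₁}))).out 0 2).mp
        (IsLocalHom.of_surjective _ Ideal.Quotient.mk_surjective))
    apply ha
    rw [← Ideal.Quotient.eq_zero_iff_mem, ← Ideal.mem_bot, ← hbot, Ideal.mem_iInf]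
    intro n
    apply Ideal.pow_right_mono hmap n
    rw [← Ideal.map_pow]
    have := Ideal.mem_map_of_mem (Ideal.Quotient.mk (Ideal.span {w₁})) (h n)
    rwa [Ideal.map_sup, Ideal.map_quotient_self, bot_sup_eq] at this
  classical
  have hn := Nat.find_spec key
  have hmin := fun k ↦ Nat.find_min key (m := k)
  set n := Nat.find key
  obtain _ | n := n
  · simp at hn
  have h1 := not_not.mp (hmin n (Nat.lt_succ_self n))
  replace h1 : a ∈ Ideal.span {w₁} ⊔ Ideal.span {w₂ ^ n} := by
    refine (sup_le le_sup_left ?_ : Ideal.span {w₁} ⊔ maximalIdeal R ^ n ≤ _) h1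
    rw [hm, Ideal.span_insert, ← Ideal.span_singleton_pow]
    exact sup_pow_le_sup_pow _ _ n
  rw [Submodule.mem_sup] at h1
  obtain ⟨y, hy, z, hz, rfl⟩ := h1
  obtain ⟨v, rfl⟩ := Ideal.mem_span_singleton'.mp hz
  refine ⟨n, v, ?_, by simpa using hy⟩
  by_contra hv
  rw [← mem_nonunits_iff, ← mem_maximalIdeal] at hv
  refine hn (add_mem (Ideal.mem_sup_left hy) (Ideal.mem_sup_right ?_))
  rw [pow_succ']
  refine Ideal.mul_mem_mul hv (Ideal.pow_mem_pow ?_ _)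
  rw [hm]
  exact Ideal.subset_span (by simp)

/-- Modulo w₁, two nonzero elements are units times powers of w₂. If their product vanished, w₂
would be nilpotent modulo w₁ and the dimension at most one. -/
theorem isPrime_span_singleton_of_maximalIdeal_eq {w₁ w₂ : R}
    (hm : maximalIdeal R = Ideal.span {w₁, w₂}) (hdim : ringKrullDim R = 2) :
    (Ideal.span {w₁}).IsPrime := by
  refine ⟨fun h ↦ ?_, fun {a b} hab ↦ ?_⟩
  · have := ringKrullDim_le_one_of_pow_mem hm (n := 0) (h ▸ Submodule.mem_top)
    rw [hdim] at this
    exact absurd this (by decide)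
  · by_contra! h
    obtain ⟨i, v, hv, hi⟩ := exists_eq_unit_mul_pow_add hm h.1
    obtain ⟨j, v', hv', hj⟩ := exists_eq_unit_mul_pow_add hm h.2
    have hp : (v * v') * w₂ ^ (i + j) ∈ Ideal.span {w₁} := by
      have := sub_mem hab (add_mem (Ideal.mul_mem_left _ a hj)
        (Ideal.mul_mem_left _ (v' * w₂ ^ j) hi))
      convert this using 1
      ring
    rw [Ideal.unit_mul_mem_iff_mem _ (hv.mul hv')] at hp
    have := ringKrullDim_le_one_of_pow_mem hm hp
    rw [hdim] at this
    exact absurd this (by decide)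

theorem notMem_span_singleton_of_maximalIdeal_eq {w₁ w₂ : R}
    (hm : maximalIdeal R = Ideal.span {w₁, w₂}) (hdim : ringKrullDim R = 2) :
    w₂ ∉ Ideal.span {w₁} := fun h ↦ by
  have := ringKrullDim_le_one_of_pow_mem hm (n := 1) (by simpa using h)
  rw [hdim] at this
  exact absurd this (by decide)

/-- A Noetherian local ring of dimension two whose maximal ideal is generated by two elements
is a domain. -/
theorem isDomain_of_maximalIdeal_eq_span_pair {z₁ z₂ : R}
    (hm : maximalIdeal R = Ideal.span {z₁, z₂}) (hdim : ringKrullDim R = 2) : IsDomain R := by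
  have hw (j : ℕ) : maximalIdeal R = Ideal.span {z₁ + z₂ ^ (j + 1), z₂} := by
    rw [hm]
    apply le_antisymm <;> rw [Ideal.span_le]
    · rintro y (rfl | rfl)
      · exact Ideal.mem_span_pair.mpr ⟨1, - z₂ ^ j, by ring⟩
      · exact Ideal.subset_span (by simp)
    · rintro y (rfl | rfl)
      · exact Ideal.mem_span_pair.mpr ⟨1, z₂ ^ j, by ring⟩
      · exact Ideal.subset_span (by simp)
  -- Infinitely many distinct principal primes: if two coincided, the difference of their
  -- generators, a unit times a power of z₂, would force z₂ into the prime.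
  have hinj : Function.Injective fun j : ℕ ↦ Ideal.span {z₁ + z₂ ^ (j + 1)} := by
    intro i j hij
    by_contra hne
    wlog hlt : i < j generalizing i j
    · exact this hij.symm (Ne.symm hne) (by omega)
    obtain ⟨d, rfl⟩ := Nat.exists_eq_add_of_lt hlt
    have hP := isPrime_span_singleton_of_maximalIdeal_eq (hw i) hdim
    have h₂ := notMem_span_singleton_of_maximalIdeal_eq (hw i) hdim
    have h1 : z₁ + z₂ ^ (i + 1) ∈ Ideal.span {z₁ + z₂ ^ (i + 1)} :=
      Ideal.mem_span_singleton_self _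
    have h2 : z₁ + z₂ ^ (i + d + 1 + 1) ∈ Ideal.span {z₁ + z₂ ^ (i + 1)} := by
      have := Ideal.mem_span_singleton_self (z₁ + z₂ ^ (i + d + 1 + 1))
      exact (show Ideal.span {z₁ + z₂ ^ (i + 1)} = Ideal.span {z₁ + z₂ ^ (i + d + 1 + 1)} from hij) ▸ this
    have h3 : (1 - z₂ ^ (d + 1)) * z₂ ^ (i + 1) ∈ Ideal.span {z₁ + z₂ ^ (i + 1)} := by
      convert sub_mem h1 h2 using 1
      ring
    have hu : IsUnit (1 - z₂ ^ (d + 1)) := by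
      have hz : z₂ ∈ maximalIdeal R := hm ▸ Ideal.subset_span (by simp)
      have : z₂ ^ (d + 1) ∈ maximalIdeal R := Ideal.pow_mem_of_mem _ hz _ (by omega)
      exact isUnit_one_sub_self_of_mem_nonunits _ ((mem_maximalIdeal _).mp this)
    rw [Ideal.unit_mul_mem_iff_mem _ hu] at h3
    exact h₂ (hP.mem_of_pow_mem _ h3)
  obtain ⟨j, hj⟩ : ∃ j : ℕ, Ideal.span {z₁ + z₂ ^ (j + 1)} ∉ minimalPrimes R := by
    by_contra! h
    exact Set.infinite_of_injective_forall_mem hinj h (minimalPrimes.finite_of_isNoetherianRing R)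
  have hP := isPrime_span_singleton_of_maximalIdeal_eq (hw j) hdim
  set w := z₁ + z₂ ^ (j + 1) with hwdef
  obtain ⟨P, hPmin, hPle⟩ := Ideal.exists_minimalPrimes_le (bot_le : ⊥ ≤ Ideal.span {w})
  have hPp : P.IsPrime := hPmin.1.1
  have hwP : w ∉ P := fun h ↦ hj (by
    rwa [← le_antisymm hPle ((Ideal.span_singleton_le_iff_mem _).mpr h)])
  -- Every element of P is a multiple qw, and w ∉ P gives q ∈ P. Hence P = wP, and P = 0 by
  -- Nakayama.
  have hbot : P = ⊥ := by
    refine Submodule.eq_bot_of_le_smul_of_le_jacobson_bot (maximalIdeal R) P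
      (IsNoetherian.noetherian _) (fun p hp ↦ ?_) (IsLocalRing.maximalIdeal_le_jacobson _)
    obtain ⟨q, rfl⟩ := Ideal.mem_span_singleton'.mp (hPle hp)
    have hq := (hPp.mem_or_mem hp).resolve_right hwP
    rw [mul_comm]
    exact Submodule.smul_mem_smul (hw j ▸ Ideal.subset_span (by simp [hwdef])) hq
  have : (⊥ : Ideal R).IsPrime := hbot ▸ hPp
  exact IsDomain.of_bot_isPrime R

end RegularLocal

/-! ### Gorenstein Artinian rings and simple socles -/

section Gorenstein

/-- The ring has a nonzero element that is a multiple of every nonzero element. For Artinian local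
rings this says that the socle is simple. -/
def HasLeastNonzeroIdeal (A : Type*) [CommRing A] : Prop :=
  ∃ s : A, s ≠ 0 ∧ ∀ x : A, x ≠ 0 → x ∣ s

theorem HasLeastNonzeroIdeal.of_ringEquiv {A B : Type*} [CommRing A] [CommRing B] (e : A ≃+* B)
    (h : HasLeastNonzeroIdeal A) : HasLeastNonzeroIdeal B := by
  obtain ⟨s, hs, h⟩ := h
  refine ⟨e s, by simpa using hs, fun x hx ↦ ?_⟩
  have := map_dvd e (h (e.symm x) (by simpa using hx))
  simpa using this

theorem IsGorensteinLocalRing.of_ringEquiv {A B : Type u} [CommRing A] [CommRing B] (e : A ≃+* B)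
    (h : IsGorensteinLocalRing A) : IsGorensteinLocalRing B := by
  obtain ⟨h₁, h₂, d, hd⟩ := h
  refine ⟨e.isLocalRing, isNoetherianRing_of_ringEquiv A e, d, ?_⟩
  let := RingHomInvPair.of_ringEquiv e
  let := RingHomInvPair.of_ringEquiv e.symm
  let f : ModuleCat.of A A ≃ₛₗ[RingHomClass.toRingHom e] ModuleCat.of B B :=
    { e with map_smul' := fun r x ↦ by simp }
  exact (ModuleCat.hasInjectiveDimensionLE_iff_of_semiLinearEquiv e f d).mp hd

/-- In an Artinian local ring every nonzero ideal contains a nonzero element killed by the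
maximal ideal. -/
theorem exists_mem_ne_zero_and_mul_eq_zero {A : Type*} [CommRing A] [IsLocalRing A]
    [IsArtinianRing A] {x : A} (hx : x ≠ 0) :
    ∃ r : A, x * r ≠ 0 ∧ ∀ a ∈ maximalIdeal A, a * (x * r) = 0 := by
  obtain ⟨N, hN⟩ := IsArtinianRing.isNilpotent_jacobson_bot (R := A)
  rw [IsLocalRing.jacobson_eq_maximalIdeal _ bot_ne_top] at hN
  classical
  -- The least n with x·mⁿ = 0 is positive; any nonzero element of x·mⁿ⁻¹ will do.
  have key : ∃ n, ∀ r ∈ maximalIdeal A ^ n, x * r = 0 := ⟨N, fun r hr ↦ by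
    rw [hN] at hr
    rw [show r = 0 by simpa using hr, mul_zero]⟩
  have h1 := Nat.find_spec key
  have h2 := fun k ↦ Nat.find_min key (m := k)
  obtain hn | ⟨n, hn⟩ : Nat.find key = 0 ∨ ∃ n, Nat.find key = n + 1 := by
    cases Nat.find key <;> simp
  · rw [hn] at h1
    exact absurd (by simpa using h1 1 (by simp)) hx
  · rw [hn] at h1 h2
    obtain ⟨r, hr⟩ := not_forall.mp (h2 n (Nat.lt_succ_self n))
    obtain ⟨hr, hr'⟩ := Classical.not_imp.mp hr
    refine ⟨r, hr', fun a ha ↦ ?_⟩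
    rw [mul_left_comm]
    exact h1 _ (by rw [pow_succ']; exact Ideal.mul_mem_mul ha hr)

open Abelian

/-- The vanishing of `Ext` on the residue field implies the vanishing on all finite modules. -/
theorem ext_eq_zero_of_residueField {A : Type u} [CommRing A] [IsLocalRing A] [IsArtinianRing A]
    (Y : ModuleCat.{u} A) (n : ℕ)
    (h : ∀ e : Ext (ModuleCat.of A (ResidueField A)) Y n, e = 0)
    (M : Type u) [AddCommGroup M] [Module A M] [hM : Module.Finite A M] :
    ∀ e : Ext (ModuleCat.of A M) Y n, e = 0 := by
  induction hM using IsNoetherianRing.induction_on_isQuotientEquivQuotientPrime A with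
  | subsingleton N =>
    intro e
    have h0 : 𝟙 (ModuleCat.of A N) = 0 := by
      ext x; exact Subsingleton.elim _ _
    rw [← Ext.mk₀_id_comp e, h0, Ext.mk₀_zero, Ext.zero_comp]
  | quotient N p f =>
    intro e
    have hp : p.1 = maximalIdeal A := by
      have := p.2
      exact IsLocalRing.eq_maximalIdeal inferInstance
    let f' : ModuleCat.of A N ≅ ModuleCat.of A (ResidueField A) :=
      (f.trans (Submodule.quotEquivOfEq _ _ hp)).toModuleIso
    have := h ((Ext.mk₀ f'.inv).comp e (zero_add n))
    have h' := congrArg (fun t ↦ (Ext.mk₀ f'.hom).comp t (zero_add n)) this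
    simpa using h'
  | exact N₁ N₂ N₃ f g hf hg hfg h₁ h₃ =>
    intro e
    have S := ModuleCat.shortComplex_shortExact
      (ModuleCat.shortComplexOfCompEqZero f g hfg.linearMap_comp_eq_zero) hfg hf hg
    obtain ⟨e', rfl⟩ := Ext.contravariant_sequence_exact₂ S Y e (h₁ _)
    rw [h₃ e', Ext.comp_zero]

/-- An Artinian local ring of finite injective dimension over itself is self-injective. -/
theorem ext_one_eq_zero_of_hasInjectiveDimensionLE {A : Type u} [CommRing A] [IsLocalRing A]
    [IsArtinianRing A] {d : ℕ} (hd : HasInjectiveDimensionLE (ModuleCat.of A A) d)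
    (M : Type u) [AddCommGroup M] [Module A M] [Module.Finite A M]
    (e : Ext (ModuleCat.of A M) (ModuleCat.of A A) 1) : e = 0 := by
  -- Descending induction on the degree i, with j = d + 1 - i; it starts above the injective
  -- dimension.
  suffices H : ∀ i j : ℕ, i + j = d + 1 → 1 ≤ i → ∀ (M : Type u) [AddCommGroup M] [Module A M]
      [Module.Finite A M] (e : Ext (ModuleCat.of A M) (ModuleCat.of A A) i), e = 0 from
    H 1 d (by omega) le_rfl M e
  intro i j
  induction j generalizing i with
  | zero =>
    intro hi _ M _ _ _ e
    exact e.eq_zero_of_hasInjectiveDimensionLT (d + 1) (by omega)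
  | succ j ih =>
    intro hij hi M _ _ _
    refine ext_eq_zero_of_residueField _ _ (fun e ↦ ?_) M
    obtain ⟨s, hs, hs'⟩ := exists_mem_ne_zero_and_mul_eq_zero (one_ne_zero (α := A))
    rw [one_mul] at hs hs'
    let f : ResidueField A →ₗ[A] A := Submodule.liftQ (maximalIdeal A)
      (LinearMap.toSpanSingleton A A s) (fun a ha ↦ by simpa using hs' a ha)
    have hf : Function.Injective f := by
      rw [← LinearMap.ker_eq_bot]
      refine Submodule.ker_liftQ_eq_bot _ _ _ fun a ha ↦ ?_
      by_contra hu
      rw [mem_maximalIdeal, mem_nonunits_iff, not_not] at hu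
      exact hs (hu.mul_right_eq_zero.mp (by simpa using ha))
    have S := ModuleCat.shortComplex_shortExact
      (ModuleCat.shortComplexOfCompEqZero f (LinearMap.range f).mkQ
        f.exact_map_mkQ_range.linearMap_comp_eq_zero) f.exact_map_mkQ_range hf
        (Submodule.mkQ_surjective _)
    -- The socle element embeds k in A. As Ext in degree i + 1 vanishes on the cokernel, `e` comes
    -- from Ext in degree i ≥ 1 of the free module A, which is zero.
    obtain ⟨e', rfl⟩ := Ext.contravariant_sequence_exact₁ S (ModuleCat.of A A) e
      (add_comm 1 i) (ih (i + 1) (by omega) (by omega) _ _)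
    have : e' = 0 := by
      obtain ⟨i, rfl⟩ := Nat.exists_eq_add_of_le' hi
      have : Projective (ModuleCat.of A A) := inferInstance
      exact Ext.eq_zero_of_projective (P := ModuleCat.of A A) e'
    rw [this, Ext.comp_zero]

/-- The obstruction to extending a map I → A to A lies in Ext¹(A/I, A). -/
theorem baer_of_hasInjectiveDimensionLE {A : Type u} [CommRing A] [IsLocalRing A]
    [IsArtinianRing A] {d : ℕ} (hd : HasInjectiveDimensionLE (ModuleCat.of A A) d) :
    Module.Baer A A := by
  intro I g
  have S := ModuleCat.shortComplex_shortExact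
    (ModuleCat.shortComplexOfCompEqZero I.subtype I.mkQ
      (by ext x; exact Ideal.Quotient.eq_zero_iff_mem.mpr x.2)) (by
        change Function.Exact I.subtype I.mkQ
        rw [LinearMap.exact_iff]; simp) I.subtype_injective
      (Submodule.mkQ_surjective _)
  obtain ⟨e, he⟩ := Ext.contravariant_sequence_exact₁ S (ModuleCat.of A A)
    (Ext.mk₀ (ModuleCat.ofHom g)) (add_comm 1 0)
    (ext_one_eq_zero_of_hasInjectiveDimensionLE hd (A ⧸ I) _)
  obtain ⟨e, rfl⟩ := Ext.homEquiv₀.symm.surjective e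
  rw [Ext.homEquiv₀_symm_apply, Ext.mk₀_comp_mk₀] at he
  replace he := (Ext.mk₀_bijective _ _).injective he
  exact ⟨e.hom, fun x hx ↦ congr(($he).hom ⟨x, hx⟩)⟩

/-- Nonzero elements killed by m generate copies of the residue field. An isomorphism between two of
them extends to an endomorphism of A, which is a multiplication, so each is a multiple of the other;
and every nonzero x has such a multiple. -/
theorem IsGorensteinLocalRing.hasLeastNonzeroIdeal {A : Type u} [CommRing A] [IsArtinianRing A]
    (h : IsGorensteinLocalRing A) : HasLeastNonzeroIdeal A := by
  obtain ⟨_, _, d, hd⟩ := h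
  have hB := baer_of_hasInjectiveDimensionLE hd
  obtain ⟨s, hs, hs'⟩ := exists_mem_ne_zero_and_mul_eq_zero (one_ne_zero (α := A))
  rw [one_mul] at hs hs'
  refine ⟨s, hs, fun x hx ↦ ?_⟩
  obtain ⟨r, hr, hr'⟩ := exists_mem_ne_zero_and_mul_eq_zero hx
  have hker : LinearMap.ker (LinearMap.toSpanSingleton A A (x * r)) ≤
      LinearMap.ker (LinearMap.toSpanSingleton A A s) := fun a ha ↦ by
    have ham : a ∈ maximalIdeal A := by
      by_contra hu
      rw [mem_maximalIdeal, mem_nonunits_iff, not_not] at hu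
      exact hr (hu.mul_right_eq_zero.mp (by simpa using ha))
    simpa using hs' a ham
  let e := LinearMap.quotKerEquivRange (LinearMap.toSpanSingleton A A (x * r))
  let g₀ : LinearMap.range (LinearMap.toSpanSingleton A A (x * r)) →ₗ[A] A :=
    (Submodule.liftQ _ (LinearMap.toSpanSingleton A A s) hker) ∘ₗ e.symm.toLinearMap
  obtain ⟨g, hg⟩ := hB (LinearMap.range (LinearMap.toSpanSingleton A A (x * r))) g₀
  have hmem : x * r ∈ LinearMap.range (LinearMap.toSpanSingleton A A (x * r)) := ⟨1, by simp⟩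
  have h1 := hg (x * r) hmem
  have h2 : e.symm ⟨x * r, hmem⟩ = Submodule.Quotient.mk 1 := by
    rw [LinearEquiv.symm_apply_eq]
    ext
    change x * r = (1 : A) • (x * r)
    rw [one_smul]
  have h3 : g (x * r) = s := by
    rw [h1]
    change Submodule.liftQ _ (LinearMap.toSpanSingleton A A s) hker (e.symm ⟨x * r, hmem⟩) = s
    rw [h2, Submodule.liftQ_apply, LinearMap.toSpanSingleton_apply, one_smul]
  refine ⟨r * g 1, ?_⟩
  rw [← h3, ← mul_assoc, ← smul_eq_mul (x * r) (g 1), ← map_smul, smul_eq_mul, mul_one]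

/-- A functional on a finite dimensional algebra that does not vanish on the least nonzero ideal
is nondegenerate. -/
theorem exists_eq_mul_of_hasLeastNonzeroIdeal {k A : Type*} [Field k] [CommRing A] [Algebra k A]
    {s : A} (hs : ∀ x : A, x ≠ 0 → x ∣ s) {φ : A →ₗ[k] k} (hφ : φ s ≠ 0)
    {x : A} (hx : ∀ a, φ (x * a) = 0) : x = 0 := by
  by_contra h
  obtain ⟨a, rfl⟩ := hs x h
  exact hφ (hx a)

/-- The nondegenerate form φ(xy) identifies A with its dual. A map g : I → A extends because the
functional φ ∘ g extends k-linearly and is represented by some c; then φ((cx - g x)a) = 0 for all a,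
so g is multiplication by c. -/
theorem HasLeastNonzeroIdeal.baer (k : Type*) {A : Type u} [Field k] [CommRing A] [Algebra k A]
    [Module.Finite k A] (h : HasLeastNonzeroIdeal A) : Module.Baer A A := by
  obtain ⟨s, hs, h⟩ := h
  obtain ⟨φ, hφ⟩ : ∃ φ : Module.Dual k A, φ s ≠ 0 := by
    by_contra! hc
    exact hs ((Module.forall_dual_apply_eq_zero_iff k s).mp hc)
  intro I g
  let Φ : A →ₗ[k] Module.Dual k A := (LinearMap.mul k A).compr₂ φ
  have hinj : Function.Injective Φ := by
    rw [← LinearMap.ker_eq_bot, LinearMap.ker_eq_bot']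
    intro x hx
    exact exists_eq_mul_of_hasLeastNonzeroIdeal h hφ fun a ↦ congr($hx a)
  have hsurj : Function.Surjective Φ :=
    (LinearMap.injective_iff_surjective_of_finrank_eq_finrank Subspace.dual_finrank_eq.symm).mp hinj
  obtain ⟨ψ, hψ⟩ := LinearMap.exists_extend
    (p := I.restrictScalars k) (φ ∘ₗ (g.restrictScalars k : I.restrictScalars k →ₗ[k] A))
  obtain ⟨c, rfl⟩ := hsurj ψ
  refine ⟨LinearMap.toSpanSingleton A A c, fun x hx ↦ ?_⟩
  rw [← sub_eq_zero]
  refine exists_eq_mul_of_hasLeastNonzeroIdeal h hφ fun a ↦ ?_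
  have h1 := congr($hψ ⟨a * x, I.mul_mem_left a hx⟩)
  have h2 : g ⟨a * x, I.mul_mem_left a hx⟩ = a * g ⟨x, hx⟩ :=
    map_smul g a ⟨x, hx⟩
  have h3 : φ (c * (a * x)) = φ (a * g ⟨x, hx⟩) := by
    rw [← h2]; exact h1
  rw [sub_mul, map_sub, sub_eq_zero, LinearMap.toSpanSingleton_apply, smul_eq_mul,
    mul_comm (g _) a, ← h3]
  congr 1
  ring

/-- A finite dimensional local algebra is Gorenstein if and only if its socle is simple. -/
theorem isGorensteinLocalRing_iff (k : Type*) {A : Type u} [Field k] [CommRing A] [Algebra k A]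
    [Module.Finite k A] [IsLocalRing A] : IsGorensteinLocalRing A ↔ HasLeastNonzeroIdeal A := by
  have : IsArtinianRing A := IsArtinianRing.of_finite k A
  refine ⟨fun h ↦ h.hasLeastNonzeroIdeal, fun h ↦ ⟨inferInstance, inferInstance, 0, ?_⟩⟩
  have : Module.Injective A A := (h.baer k).injective
  have := Module.injective_object_of_injective_module A A
  exact injective_iff_hasInjectiveDimensionLT_one.mp this

end Gorenstein

/-! ### Lengths of quotients -/

section Length

variable (k : Type*) {R : Type*} [Field k] [CommRing R] [Algebra k R]

theorem finite_quotient_of_le {I J : Ideal R} (h : I ≤ J) [Module.Finite k (R ⧸ I)] :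
    Module.Finite k (R ⧸ J) :=
  Module.Finite.of_surjective (Ideal.Quotient.factorₐ k h).toLinearMap
    (Ideal.Quotient.factor_surjective h)

theorem finrank_quotient_le_of_le {I J : Ideal R} (h : I ≤ J) [Module.Finite k (R ⧸ I)] :
    Module.finrank k (R ⧸ J) ≤ Module.finrank k (R ⧸ I) :=
  LinearMap.finrank_le_finrank_of_surjective (f := (Ideal.Quotient.factorₐ k h).toLinearMap)
    (Ideal.Quotient.factor_surjective h)

/-- Additivity of the length in `0 → R / (J : z) → R / J → R / (J, z) → 0`. -/
theorem finite_and_finrank_quotient_eq {J J' : Ideal R} {z : R} (h : ∀ r, r ∈ J' ↔ z * r ∈ J)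
    [Module.Finite k (R ⧸ J')] [Module.Finite k (R ⧸ (J ⊔ Ideal.span {z}))] :
    Module.Finite k (R ⧸ J) ∧ Module.finrank k (R ⧸ J) =
      Module.finrank k (R ⧸ J') + Module.finrank k (R ⧸ (J ⊔ Ideal.span {z})) := by
  let f : (R ⧸ J') →ₗ[k] (R ⧸ J) :=
    (Submodule.mapQ J' J (LinearMap.mulLeft R z) fun r hr ↦ (h r).mp hr).restrictScalars k
  let g : (R ⧸ J) →ₗ[k] (R ⧸ (J ⊔ Ideal.span {z})) :=
    (Ideal.Quotient.factorₐ k le_sup_left).toLinearMap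
  have hg : Function.Surjective g := Ideal.Quotient.factor_surjective le_sup_left
  have hf : Function.Injective f := by
    rw [injective_iff_map_eq_zero]
    intro a ha
    obtain ⟨r, rfl⟩ := Ideal.Quotient.mk_surjective a
    exact Ideal.Quotient.eq_zero_iff_mem.mpr ((h r).mpr (Ideal.Quotient.eq_zero_iff_mem.mp ha))
  have hfg : LinearMap.range f = LinearMap.ker g := by
    ext a
    obtain ⟨r, rfl⟩ := Ideal.Quotient.mk_surjective a
    constructor
    · rintro ⟨b, hb⟩
      obtain ⟨s, rfl⟩ := Ideal.Quotient.mk_surjective b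
      have hb' : Ideal.Quotient.mk J (z * s) = Ideal.Quotient.mk J r := hb
      rw [← hb']
      exact Ideal.Quotient.eq_zero_iff_mem.mpr
        (Ideal.mem_sup_right (Ideal.mul_mem_right _ _ (Ideal.mem_span_singleton_self z)))
    · intro hr
      obtain ⟨y, hy, w, hw, rfl⟩ := Submodule.mem_sup.mp (Ideal.Quotient.eq_zero_iff_mem.mp hr)
      obtain ⟨s, rfl⟩ := Ideal.mem_span_singleton.mp hw
      refine ⟨Ideal.Quotient.mk J' s, ?_⟩
      change Ideal.Quotient.mk J (z * s) = _
      rw [map_add, Ideal.Quotient.eq_zero_iff_mem.mpr hy, zero_add]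
  have h1 : Module.Finite k (LinearMap.ker g) := hfg ▸ Module.Finite.range f
  have h2 : Module.Finite k ((R ⧸ J) ⧸ LinearMap.ker g) :=
    Module.Finite.equiv (g.quotKerEquivOfSurjective hg).symm
  have h3 : Module.Finite k (R ⧸ J) := Module.Finite.of_submodule_quotient (LinearMap.ker g)
  refine ⟨h3, ?_⟩
  rw [← LinearMap.finrank_range_add_finrank_ker g, LinearMap.range_eq_top.mpr hg, finrank_top,
    ← hfg, LinearMap.finrank_range_of_inj hf, add_comm]

theorem finite_and_finrank_quotient_le {J J' : Ideal R} {z : R} (h : ∀ r ∈ J', z * r ∈ J)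
    [Module.Finite k (R ⧸ J')] [Module.Finite k (R ⧸ (J ⊔ Ideal.span {z}))] :
    Module.Finite k (R ⧸ J) ∧ Module.finrank k (R ⧸ J) ≤
      Module.finrank k (R ⧸ J') + Module.finrank k (R ⧸ (J ⊔ Ideal.span {z})) := by
  let C : Ideal R := Submodule.comap (LinearMap.mulLeft R z) J
  have hC : J' ≤ C := h
  have := finite_quotient_of_le k hC
  obtain ⟨h1, h2⟩ := finite_and_finrank_quotient_eq k (J := J) (J' := C) (z := z) fun _ ↦ Iff.rfl
  exact ⟨h1, h2.trans_le (Nat.add_le_add_right (finrank_quotient_le_of_le k hC) _)⟩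

variable [IsLocalRing R]

theorem finite_and_finrank_quotient_maximalIdeal
    (hres : ∀ r : R, ∃ c : k, r - algebraMap k R c ∈ maximalIdeal R) :
    Module.Finite k (R ⧸ maximalIdeal R) ∧ Module.finrank k (R ⧸ maximalIdeal R) = 1 := by
  have h1 : (1 : R ⧸ maximalIdeal R) ≠ 0 := one_ne_zero
  have h2 : ∀ w : R ⧸ maximalIdeal R, ∃ c : k, c • (1 : R ⧸ maximalIdeal R) = w := fun w ↦ by
    obtain ⟨r, rfl⟩ := Ideal.Quotient.mk_surjective w
    obtain ⟨c, hc⟩ := hres r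
    refine ⟨c, ?_⟩
    rw [← Algebra.algebraMap_eq_smul_one, eq_comm]
    exact Ideal.Quotient.eq.mpr hc
  have h3 := (finrank_eq_one_iff_of_nonzero' 1 h1).mpr h2
  exact ⟨Module.finite_of_finrank_eq_succ h3, h3⟩

variable [IsNoetherianRing R]
  (hres : ∀ r : R, ∃ c : k, r - algebraMap k R c ∈ maximalIdeal R)
  {z₁ z₂ : R} (hm : maximalIdeal R = Ideal.span {z₁, z₂}) (hdim : ringKrullDim R = 2)

include hres hm hdim

/-- As z₂ is a nonzerodivisor modulo z₁, the colon ideal of (z₁, z₂ᵇ⁺¹) by z₂ is (z₁, z₂ᵇ), and each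
step adds dim R/m = 1. -/
theorem finite_and_finrank_quotient_span_pow_right (b : ℕ) :
    Module.Finite k (R ⧸ Ideal.span {z₁, z₂ ^ b}) ∧
      Module.finrank k (R ⧸ Ideal.span {z₁, z₂ ^ b}) = b := by
  have hP := isPrime_span_singleton_of_maximalIdeal_eq hm hdim
  have hz₂ := notMem_span_singleton_of_maximalIdeal_eq hm hdim
  induction b with
  | zero =>
    have : Ideal.span {z₁, z₂ ^ 0} = ⊤ := (Ideal.eq_top_iff_one _).mpr (Ideal.subset_span (by simp))
    have : Subsingleton (R ⧸ Ideal.span {z₁, z₂ ^ 0}) := Ideal.Quotient.subsingleton_iff.mpr this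
    exact ⟨inferInstance, Module.finrank_zero_of_subsingleton⟩
  | succ b ih =>
    obtain ⟨_, ih⟩ := ih
    have hsup : Ideal.span {z₁, z₂ ^ (b + 1)} ⊔ Ideal.span {z₂} = maximalIdeal R := by
      rw [hm, Ideal.span_insert, Ideal.span_insert, sup_assoc]
      congr 1
      exact sup_eq_right.mpr (Ideal.span_singleton_le_span_singleton.mpr (dvd_pow_self _ (by simp)))
    obtain ⟨h1, h2⟩ := finite_and_finrank_quotient_maximalIdeal k hres
    rw [← hsup] at h1 h2
    have h (r : R) : r ∈ Ideal.span {z₁, z₂ ^ b} ↔ z₂ * r ∈ Ideal.span {z₁, z₂ ^ (b + 1)} := by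
      simp only [Ideal.mem_span_pair]
      constructor
      · rintro ⟨u, v, rfl⟩
        exact ⟨z₂ * u, v, by ring⟩
      · rintro ⟨u, v, h⟩
        have h3 : z₂ * (r - v * z₂ ^ b) ∈ Ideal.span {z₁} :=
          Ideal.mem_span_singleton'.mpr ⟨u, by linear_combination h⟩
        obtain ⟨w, hw⟩ := Ideal.mem_span_singleton'.mp ((hP.mem_or_mem h3).resolve_left hz₂)
        exact ⟨w, v, by linear_combination hw⟩
    obtain ⟨h4, h5⟩ := finite_and_finrank_quotient_eq k h
    exact ⟨h4, by rw [h5, ih, h2]⟩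

/-- As z₂ᵇ is a nonzerodivisor modulo z₁, the colon ideal of (z₁ᵃ⁺¹, z₂ᵇ) by z₁ is (z₁ᵃ, z₂ᵇ), and
each step adds dim R/(z₁, z₂ᵇ) = b. -/
theorem finite_and_finrank_quotient_span_pow_pow (a b : ℕ) :
    Module.Finite k (R ⧸ Ideal.span {z₁ ^ a, z₂ ^ b}) ∧
      Module.finrank k (R ⧸ Ideal.span {z₁ ^ a, z₂ ^ b}) = a * b := by
  have hP := isPrime_span_singleton_of_maximalIdeal_eq hm hdim
  have hz₂ := notMem_span_singleton_of_maximalIdeal_eq hm hdim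
  have hz₁ : z₁ ≠ 0 := by
    rintro rfl
    exact notMem_span_singleton_of_maximalIdeal_eq (hm.trans (by rw [Set.pair_comm])) hdim
      (zero_mem _)
  have := isDomain_of_maximalIdeal_eq_span_pair hm hdim
  induction a with
  | zero =>
    have : Ideal.span {z₁ ^ 0, z₂ ^ b} = ⊤ :=
      (Ideal.eq_top_iff_one _).mpr (Ideal.subset_span (by simp))
    have : Subsingleton (R ⧸ Ideal.span {z₁ ^ 0, z₂ ^ b}) := Ideal.Quotient.subsingleton_iff.mpr this
    exact ⟨inferInstance, by rw [Module.finrank_zero_of_subsingleton, zero_mul]⟩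
  | succ a ih =>
    obtain ⟨_, ih⟩ := ih
    have hsup : Ideal.span {z₁ ^ (a + 1), z₂ ^ b} ⊔ Ideal.span {z₁} = Ideal.span {z₁, z₂ ^ b} := by
      rw [Ideal.span_insert, Ideal.span_insert, sup_right_comm]
      congr 1
      exact sup_eq_right.mpr (Ideal.span_singleton_le_span_singleton.mpr (dvd_pow_self _ (by simp)))
    obtain ⟨h1, h2⟩ := finite_and_finrank_quotient_span_pow_right k hres hm hdim b
    rw [← hsup] at h1 h2
    have h : ∀ r, r ∈ Ideal.span {z₁ ^ a, z₂ ^ b} ↔ z₁ * r ∈ Ideal.span {z₁ ^ (a + 1), z₂ ^ b} := by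
      intro r
      simp only [Ideal.mem_span_pair]
      constructor
      · rintro ⟨u, v, rfl⟩
        exact ⟨u, z₁ * v, by ring⟩
      · rintro ⟨u, v, h⟩
        have h3 : v * z₂ ^ b ∈ Ideal.span {z₁} :=
          Ideal.mem_span_singleton'.mpr ⟨r - u * z₁ ^ a, by linear_combination -h⟩
        obtain ⟨w, rfl⟩ := Ideal.mem_span_singleton'.mp
          ((hP.mem_or_mem h3).resolve_right fun h ↦ hz₂ (hP.mem_of_pow_mem _ h))
        exact ⟨u, w, mul_left_cancel₀ hz₁ (by linear_combination h)⟩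
    obtain ⟨h4, h5⟩ := finite_and_finrank_quotient_eq k h
    exact ⟨h4, by rw [h5, ih, h2]; ring⟩

/-- Since z₁mⁱ ⊆ mⁱ⁺¹, passing from i to i + 1 adds at most dim R/(z₁, z₂ⁱ⁺¹) = i + 1. Only the
upper bound is needed later. -/
theorem finite_and_finrank_quotient_maximalIdeal_pow (i : ℕ) :
    Module.Finite k (R ⧸ maximalIdeal R ^ i) ∧
      2 * Module.finrank k (R ⧸ maximalIdeal R ^ i) ≤ i * (i + 1) := by
  induction i with
  | zero =>
    have : Subsingleton (R ⧸ maximalIdeal R ^ 0) :=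
      Ideal.Quotient.subsingleton_iff.mpr (by simp)
    exact ⟨inferInstance, by rw [Module.finrank_zero_of_subsingleton]⟩
  | succ i ih =>
    obtain ⟨_, ih⟩ := ih
    have hsup : maximalIdeal R ^ (i + 1) ⊔ Ideal.span {z₁} = Ideal.span {z₁, z₂ ^ (i + 1)} := by
      rw [Ideal.span_insert, ← Ideal.span_singleton_pow, sup_comm]
      apply le_antisymm
      · refine sup_le le_sup_left ?_
        rw [hm, Ideal.span_insert]
        exact sup_pow_le_sup_pow _ _ _
      · refine sup_le_sup_left (Ideal.pow_right_mono ?_ _) _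
        rw [hm, Ideal.span_insert]
        exact le_sup_right
    obtain ⟨h1, h2⟩ := finite_and_finrank_quotient_span_pow_right k hres hm hdim (i + 1)
    rw [← hsup] at h1 h2
    obtain ⟨h3, h4⟩ := finite_and_finrank_quotient_le k
      (J := maximalIdeal R ^ (i + 1)) (J' := maximalIdeal R ^ i) (z := z₁) fun r hr ↦ by
        rw [pow_succ']
        exact Ideal.mul_mem_mul (hm ▸ Ideal.subset_span (by simp)) hr
    exact ⟨h3, by rw [h2] at h4; nlinarith⟩

end Length

/-! ### Duality for algebras with simple socle -/

section Duality

variable {k A : Type*} [Field k] [CommRing A] [Algebra k A] [Module.Finite k A]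

/-- In a finite dimensional algebra with simple socle, the lengths of the quotients by two ideals
of zero product add up to at least the length of the algebra. -/
theorem HasLeastNonzeroIdeal.finrank_le (h : HasLeastNonzeroIdeal A) {B C : Ideal A}
    (hBC : ∀ b ∈ B, ∀ c ∈ C, b * c = 0) :
    Module.finrank k A ≤ Module.finrank k (A ⧸ B) + Module.finrank k (A ⧸ C) := by
  obtain ⟨s, hs, h⟩ := h
  obtain ⟨φ, hφ⟩ : ∃ φ : Module.Dual k A, φ s ≠ 0 := by
    by_contra! hc
    exact hs ((Module.forall_dual_apply_eq_zero_iff k s).mp hc)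
  let Φ : A →ₗ[k] Module.Dual k A := (LinearMap.mul k A).compr₂ φ
  have hinj : Function.Injective Φ := by
    rw [← LinearMap.ker_eq_bot, LinearMap.ker_eq_bot']
    intro x hx
    exact exists_eq_mul_of_hasLeastNonzeroIdeal h hφ fun a ↦ congr($hx a)
  -- `Φ` embeds B into the functionals vanishing on C, so dim B ≤ dim A - dim C.
  have h1 : (B.restrictScalars k).map Φ ≤ (C.restrictScalars k).dualAnnihilator := by
    rintro _ ⟨b, hb, rfl⟩
    rw [Submodule.mem_dualAnnihilator]
    intro c hc
    change φ (b * c) = 0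
    rw [hBC b hb c hc, map_zero]
  have h2 := Submodule.finrank_mono h1
  rw [← (Submodule.equivMapOfInjective Φ hinj _).finrank_eq] at h2
  have h3 := Subspace.finrank_add_finrank_dualAnnihilator_eq (C.restrictScalars k)
  have h4 := Submodule.finrank_quotient_add_finrank (C.restrictScalars k)
  have h5 := Submodule.finrank_quotient_add_finrank (B.restrictScalars k)
  change Module.finrank k (A ⧸ C) + _ = _ at h4
  change Module.finrank k (A ⧸ B) + _ = _ at h5
  omega

end Duality

/-! ### Generators, socle and the length bound -/

section Koszul

variable (k : Type*) {R : Type*} [Field k] [CommRing R] [Algebra k R]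

/-- The differential `A → A²`, `c ↦ (-z₂ c, z₁ c)` of the Koszul complex of `z₁`, `z₂`
on `A = R / I`. -/
def koszulMap (I : Ideal R) (z₁ z₂ : R) : (R ⧸ I) →ₗ[k] (R ⧸ I) × (R ⧸ I) :=
  (LinearMap.mulLeft k (-Ideal.Quotient.mk I z₂)).prod (LinearMap.mulLeft k (Ideal.Quotient.mk I z₁))

theorem mem_ker_koszulMap {I : Ideal R} {z₁ z₂ : R} {c : R ⧸ I} :
    c ∈ LinearMap.ker (koszulMap k I z₁ z₂) ↔
      Ideal.Quotient.mk I z₁ * c = 0 ∧ Ideal.Quotient.mk I z₂ * c = 0 := by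
  simp [koszulMap, and_comm]

variable [IsLocalRing R] [IsNoetherianRing R]
  (hres : ∀ r : R, ∃ c : k, r - algebraMap k R c ∈ maximalIdeal R)
  {z₁ z₂ : R} (hm : maximalIdeal R = Ideal.span {z₁, z₂}) (hdim : ringKrullDim R = 2)

include hm hdim in
/-- The parameters `z₁`, `z₂` form a regular sequence. -/
theorem exists_of_mul_add_mul_eq_zero {a b : R} (h : z₁ * a + z₂ * b = 0) :
    ∃ c, a = -z₂ * c ∧ b = z₁ * c := by
  have hP := isPrime_span_singleton_of_maximalIdeal_eq hm hdim
  have hz₂ := notMem_span_singleton_of_maximalIdeal_eq hm hdim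
  have hz₁ : z₁ ≠ 0 := by
    rintro rfl
    exact notMem_span_singleton_of_maximalIdeal_eq (hm.trans (by rw [Set.pair_comm])) hdim
      (zero_mem _)
  have := isDomain_of_maximalIdeal_eq_span_pair hm hdim
  have h3 : z₂ * b ∈ Ideal.span {z₁} := Ideal.mem_span_singleton'.mpr ⟨-a, by linear_combination -h⟩
  obtain ⟨c, rfl⟩ := Ideal.mem_span_singleton'.mp ((hP.mem_or_mem h3).resolve_left hz₂)
  exact ⟨c, mul_left_cancel₀ hz₁ (by linear_combination h), mul_comm _ _⟩

omit [IsNoetherianRing R] in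
include hm in
theorem mem_maximalIdeal_mul_iff {I : Ideal R} {x : R} :
    x ∈ maximalIdeal R * I ↔ ∃ i ∈ I, ∃ j ∈ I, z₁ * i + z₂ * j = x := by
  rw [hm, Ideal.span_insert, Ideal.sup_mul, Submodule.mem_sup]
  simp only [Ideal.mem_span_singleton_mul]
  constructor
  · rintro ⟨_, ⟨i, hi, rfl⟩, _, ⟨j, hj, rfl⟩, h⟩
    exact ⟨i, hi, j, hj, h⟩
  · rintro ⟨i, hi, j, hj, h⟩
    exact ⟨_, ⟨i, hi, rfl⟩, _, ⟨j, hj, rfl⟩, h⟩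

include hres hm hdim in
/-- The Euler characteristic of the Koszul complex: the length of `R / m I` exceeds that of `R / I`
by one more than the length of the socle of `R / I`. -/
theorem finite_and_finrank_quotient_maximalIdeal_mul (I : Ideal R) [Module.Finite k (R ⧸ I)] :
    Module.Finite k (R ⧸ maximalIdeal R * I) ∧
      Module.finrank k (R ⧸ maximalIdeal R * I) = Module.finrank k (R ⧸ I) +
        Module.finrank k (LinearMap.ker (koszulMap k I z₁ z₂)) + 1 := by
  -- `σ` is only a k-linear section, but changing a lift by I changes z₁σ(a) + z₂σ(b) within mI. So
  -- `ψ` is the natural map (R/I)² → R/mI, with image m/mI.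
  obtain ⟨σ, hσ⟩ := (Ideal.Quotient.mkₐ k I).toLinearMap.exists_rightInverse_of_surjective
    (LinearMap.range_eq_top.mpr Ideal.Quotient.mk_surjective)
  replace hσ (a : R ⧸ I) : Ideal.Quotient.mk I (σ a) = a := congr($hσ a)
  have hσ' (r : R) : σ (Ideal.Quotient.mk I r) - r ∈ I := Ideal.Quotient.eq.mp (hσ _)
  let q := (Ideal.Quotient.mkₐ k (maximalIdeal R * I)).toLinearMap
  have hq {r : R} : q r = 0 ↔ r ∈ maximalIdeal R * I := Ideal.Quotient.eq_zero_iff_mem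
  let ψ : (R ⧸ I) × (R ⧸ I) →ₗ[k] R ⧸ maximalIdeal R * I :=
    q ∘ₗ ((LinearMap.mulLeft k z₁ ∘ₗ σ).coprod (LinearMap.mulLeft k z₂ ∘ₗ σ))
  have hψ (a b) : ψ (a, b) = q (z₁ * σ a + z₂ * σ b) := rfl
  let g : (R ⧸ maximalIdeal R * I) →ₗ[k] R ⧸ maximalIdeal R :=
    (Ideal.Quotient.factorₐ k Ideal.mul_le_left).toLinearMap
  have hgq (r : R) : g (q r) = Ideal.Quotient.mk (maximalIdeal R) r := rfl
  have hg : Function.Surjective g := Ideal.Quotient.factor_surjective Ideal.mul_le_left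
  have hker : LinearMap.ker ψ = LinearMap.range (koszulMap k I z₁ z₂) := by
    ext ⟨a, b⟩
    rw [LinearMap.mem_ker, hψ, hq, mem_maximalIdeal_mul_iff hm]
    constructor
    · rintro ⟨i, hi, j, hj, h⟩
      obtain ⟨c, h1, h2⟩ := exists_of_mul_add_mul_eq_zero hm hdim
        (a := σ a - i) (b := σ b - j) (by linear_combination -h)
      refine ⟨Ideal.Quotient.mk I c, ?_⟩
      ext
      · change -Ideal.Quotient.mk I z₂ * Ideal.Quotient.mk I c = a
        rw [← map_neg, ← map_mul, ← h1, map_sub, hσ, Ideal.Quotient.eq_zero_iff_mem.mpr hi, sub_zero]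
      · change Ideal.Quotient.mk I z₁ * Ideal.Quotient.mk I c = b
        rw [← map_mul, ← h2, map_sub, hσ, Ideal.Quotient.eq_zero_iff_mem.mpr hj, sub_zero]
    · rintro ⟨c, hc⟩
      obtain ⟨r, rfl⟩ := Ideal.Quotient.mk_surjective c
      have h1 : Ideal.Quotient.mk I (-z₂ * r) = a := by
        rw [map_mul, map_neg]; exact congrArg Prod.fst hc
      have h2 : Ideal.Quotient.mk I (z₁ * r) = b := by
        rw [map_mul]; exact congrArg Prod.snd hc
      rw [← h1, ← h2]
      exact ⟨_, hσ' (-z₂ * r), _, hσ' (z₁ * r), by ring⟩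
  have hrange : LinearMap.range ψ = LinearMap.ker g := by
    ext y
    obtain ⟨r, rfl⟩ := Ideal.Quotient.mk_surjective y
    change q r ∈ _ ↔ q r ∈ _
    rw [LinearMap.mem_ker, hgq, Ideal.Quotient.eq_zero_iff_mem]
    constructor
    · rintro ⟨⟨a, b⟩, h⟩
      rw [hψ, ← sub_eq_zero, ← map_sub, hq] at h
      have h1 : z₁ * σ a + z₂ * σ b ∈ maximalIdeal R := by
        rw [hm, Ideal.mem_span_pair]
        exact ⟨σ a, σ b, by ring⟩
      simpa using sub_mem h1 (Ideal.mul_le_left h)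
    · intro hr
      rw [hm, Ideal.mem_span_pair] at hr
      obtain ⟨a, b, rfl⟩ := hr
      refine ⟨(Ideal.Quotient.mk I a, Ideal.Quotient.mk I b), ?_⟩
      rw [hψ, ← sub_eq_zero, ← map_sub, hq, mem_maximalIdeal_mul_iff hm]
      exact ⟨_, hσ' a, _, hσ' b, by ring⟩
  obtain ⟨h1, h2⟩ := finite_and_finrank_quotient_maximalIdeal k hres
  have h3 : Module.Finite k (LinearMap.ker g) := hrange ▸ Module.Finite.range ψ
  have h4 : Module.Finite k ((R ⧸ maximalIdeal R * I) ⧸ LinearMap.ker g) :=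
    Module.Finite.equiv (g.quotKerEquivOfSurjective hg).symm
  have h5 : Module.Finite k (R ⧸ maximalIdeal R * I) :=
    Module.Finite.of_submodule_quotient (LinearMap.ker g)
  refine ⟨h5, ?_⟩
  -- Rank-nullity along R/I → (R/I)² → R/mI → R/m, exact at the two middle terms and on the right.
  have h6 := LinearMap.finrank_range_add_finrank_ker g
  have h7 := LinearMap.finrank_range_add_finrank_ker ψ
  have h8 := LinearMap.finrank_range_add_finrank_ker (koszulMap k I z₁ z₂)
  rw [LinearMap.range_eq_top.mpr hg, finrank_top, h2] at h6
  rw [hker, hrange, Module.finrank_prod] at h7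
  omega

-- The residue field being k, the classes of f and g span I/mI over k.
omit [IsNoetherianRing R] in
include hres in
theorem finrank_quotient_maximalIdeal_mul_le (f g : R)
    [Module.Finite k (R ⧸ maximalIdeal R * Ideal.span {f, g})] :
    Module.finrank k (R ⧸ maximalIdeal R * Ideal.span {f, g}) ≤
      Module.finrank k (R ⧸ Ideal.span {f, g}) + 2 := by
  set I := Ideal.span {f, g} with hI
  let π : (R ⧸ maximalIdeal R * I) →ₗ[k] R ⧸ I :=
    (Ideal.Quotient.factorₐ k Ideal.mul_le_right).toLinearMap
  have hπ : Function.Surjective π := Ideal.Quotient.factor_surjective Ideal.mul_le_right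
  let q := (Ideal.Quotient.mkₐ k (maximalIdeal R * I)).toLinearMap
  have hq {r : R} : q r = 0 ↔ r ∈ maximalIdeal R * I := Ideal.Quotient.eq_zero_iff_mem
  have hker : LinearMap.ker π ≤ Submodule.span k {q f, q g} := by
    intro y hy
    obtain ⟨r, rfl⟩ := Ideal.Quotient.mk_surjective y
    have hr : r ∈ I := Ideal.Quotient.eq_zero_iff_mem.mp hy
    change q r ∈ _
    obtain ⟨a, b, rfl⟩ := Ideal.mem_span_pair.mp hr
    obtain ⟨c, hc⟩ := hres a
    obtain ⟨d, hd⟩ := hres b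
    rw [Submodule.mem_span_pair]
    refine ⟨c, d, ?_⟩
    rw [← map_smul, ← map_smul, ← map_add, ← sub_eq_zero, ← map_sub, hq, ← neg_mem_iff,
      Algebra.smul_def, Algebra.smul_def]
    have := add_mem (Ideal.mul_mem_mul hc (Ideal.subset_span (by simp) : f ∈ I))
      (Ideal.mul_mem_mul hd (Ideal.subset_span (by simp) : g ∈ I))
    convert this using 1
    ring
  have h1 := LinearMap.finrank_range_add_finrank_ker π
  rw [LinearMap.range_eq_top.mpr hπ, finrank_top] at h1
  have h2 := Submodule.finrank_mono hker
  have h3 : Module.finrank k (Submodule.span k {q f, q g}) ≤ 2 := by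
    classical
    have := finrank_span_finset_le_card (R := k) {q f, q g}
    rw [Finset.coe_pair] at this
    exact this.trans Finset.card_le_two
  omega

/-- Nakayama's lemma: an ideal whose fibre has dimension two is generated by two elements. -/
theorem exists_eq_span_pair_of_finrank_eq {I : Ideal R}
    [Module.Finite k (R ⧸ maximalIdeal R * I)]
    (h : Module.finrank k (R ⧸ maximalIdeal R * I) = Module.finrank k (R ⧸ I) + 2) :
    ∃ f g, I = Ideal.span {f, g} := by
  let π : (R ⧸ maximalIdeal R * I) →ₗ[k] R ⧸ I :=
    (Ideal.Quotient.factorₐ k Ideal.mul_le_right).toLinearMap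
  have hπ : Function.Surjective π := Ideal.Quotient.factor_surjective Ideal.mul_le_right
  have h1 := LinearMap.finrank_range_add_finrank_ker π
  rw [LinearMap.range_eq_top.mpr hπ, finrank_top] at h1
  let b := Module.finBasisOfFinrankEq k (LinearMap.ker π) (n := 2) (by omega)
  obtain ⟨f, hf⟩ := Ideal.Quotient.mk_surjective (b 0 : R ⧸ maximalIdeal R * I)
  obtain ⟨g, hg⟩ := Ideal.Quotient.mk_surjective (b 1 : R ⧸ maximalIdeal R * I)
  have hfI : f ∈ I := by
    have := (b 0).2
    rw [← hf] at this
    exact Ideal.Quotient.eq_zero_iff_mem.mp this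
  have hgI : g ∈ I := by
    have := (b 1).2
    rw [← hg] at this
    exact Ideal.Quotient.eq_zero_iff_mem.mp this
  refine ⟨f, g, le_antisymm ?_ ?_⟩
  · refine Submodule.le_of_le_smul_of_le_jacobson_bot (I := maximalIdeal R)
      (IsNoetherian.noetherian _) (IsLocalRing.maximalIdeal_le_jacobson _) fun r hr ↦ ?_
    let y : LinearMap.ker π := ⟨Ideal.Quotient.mk _ r, Ideal.Quotient.eq_zero_iff_mem.mpr hr⟩
    have hy := congrArg Subtype.val (b.sum_repr y)
    rw [Fin.sum_univ_two] at hy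
    simp only [Submodule.coe_add, Submodule.coe_smul, ← hf, ← hg] at hy
    have h2 : b.repr y 0 • f + b.repr y 1 • g - r ∈ maximalIdeal R * I :=
      Ideal.Quotient.eq.mp hy
    have h3 : b.repr y 0 • f + b.repr y 1 • g ∈ Ideal.span {f, g} := by
      rw [Ideal.mem_span_pair, Algebra.smul_def, Algebra.smul_def]
      exact ⟨_, _, rfl⟩
    rw [smul_eq_mul]
    simpa using sub_mem (Ideal.mem_sup_left h3) (Ideal.mem_sup_right h2 :
      _ ∈ Ideal.span {f, g} ⊔ maximalIdeal R * I)
  · rw [Ideal.span_le]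
    rintro y (rfl | rfl) <;> assumption

omit [IsNoetherianRing R] in
theorem mk_mem_maximalIdeal_iff {I : Ideal R} [IsLocalRing (R ⧸ I)] {r : R} :
    Ideal.Quotient.mk I r ∈ maximalIdeal (R ⧸ I) ↔ r ∈ maximalIdeal R := by
  have := IsLocalHom.of_surjective (Ideal.Quotient.mk I) Ideal.Quotient.mk_surjective
  rw [mem_maximalIdeal, mem_maximalIdeal, mem_nonunits_iff, mem_nonunits_iff, isUnit_map_iff]

omit [IsNoetherianRing R] in
include hres hm in
/-- The socle of `R / I` is one-dimensional if and only if `R / I` has a least nonzero ideal. -/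
theorem hasLeastNonzeroIdeal_iff_finrank_ker_koszulMap {I : Ideal R} [Module.Finite k (R ⧸ I)]
    [IsLocalRing (R ⧸ I)] : HasLeastNonzeroIdeal (R ⧸ I) ↔
      Module.finrank k (LinearMap.ker (koszulMap k I z₁ z₂)) = 1 := by
  have : IsArtinianRing (R ⧸ I) := IsArtinianRing.of_finite k _
  have hmem {c : R ⧸ I} : c ∈ LinearMap.ker (koszulMap k I z₁ z₂) ↔
      ∀ a ∈ maximalIdeal (R ⧸ I), a * c = 0 := by
    rw [mem_ker_koszulMap]
    constructor
    · rintro ⟨h1, h2⟩ a ha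
      obtain ⟨r, rfl⟩ := Ideal.Quotient.mk_surjective a
      rw [mk_mem_maximalIdeal_iff, hm, Ideal.mem_span_pair] at ha
      obtain ⟨u, v, rfl⟩ := ha
      rw [map_add, map_mul, map_mul, add_mul, mul_assoc, mul_assoc, h1, h2]
      simp
    · intro h
      exact ⟨h _ (mk_mem_maximalIdeal_iff.mpr (hm ▸ Ideal.subset_span (by simp))),
        h _ (mk_mem_maximalIdeal_iff.mpr (hm ▸ Ideal.subset_span (by simp)))⟩
  -- On the socle R acts through its residue field k.
  have hsmul {c : R ⧸ I} (hc : c ∈ LinearMap.ker (koszulMap k I z₁ z₂)) (a : R ⧸ I) :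
      ∃ t : k, c * a = t • c := by
    obtain ⟨r, rfl⟩ := Ideal.Quotient.mk_surjective a
    obtain ⟨t, ht⟩ := hres r
    refine ⟨t, ?_⟩
    have := hmem.mp hc _ (mk_mem_maximalIdeal_iff.mpr ht)
    rw [map_sub, sub_mul, sub_eq_zero] at this
    rw [mul_comm, this, Algebra.smul_def]
    rfl
  constructor
  · rintro ⟨s, hs, h⟩
    obtain ⟨r, hr, hr'⟩ := exists_mem_ne_zero_and_mul_eq_zero hs
    refine finrank_eq_one (⟨s * r, hmem.mpr hr'⟩ : LinearMap.ker (koszulMap k I z₁ z₂))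
      (fun h ↦ hr congr(($h).1)) fun ⟨y, hy⟩ ↦ ?_
    by_cases hy0 : y = 0
    · exact ⟨0, by ext; simp [hy0]⟩
    obtain ⟨a, ha⟩ := (h y hy0).trans (Dvd.intro r rfl)
    obtain ⟨t, ht⟩ := hsmul hy a
    have ht0 : t ≠ 0 := by
      rintro rfl
      rw [ha, ht, zero_smul] at hr
      exact hr rfl
    refine ⟨t⁻¹, ?_⟩
    ext
    change t⁻¹ • (s * r) = y
    rw [ha, ht, smul_smul, inv_mul_cancel₀ ht0, one_smul]
  · intro h
    obtain ⟨⟨s, hs⟩, hs0, hs'⟩ := finrank_eq_one_iff'.mp h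
    refine ⟨s, fun h ↦ hs0 (by ext; exact h), fun x hx ↦ ?_⟩
    obtain ⟨r, hr, hr'⟩ := exists_mem_ne_zero_and_mul_eq_zero hx
    obtain ⟨t, ht⟩ := hs' ⟨x * r, hmem.mpr hr'⟩
    replace ht : t • s = x * r := congr(($ht).1)
    have ht0 : t ≠ 0 := by
      rintro rfl
      rw [zero_smul] at ht
      exact hr ht.symm
    refine ⟨t⁻¹ • r, ?_⟩
    rw [mul_smul_comm, ← ht, smul_smul, inv_mul_cancel₀ ht0, one_smul]

include hres hm hdim in
/-- In a regular local ring of dimension two, the ideals of Gorenstein colength are those generated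
by two elements. -/
theorem hasLeastNonzeroIdeal_quotient_iff {I : Ideal R} (hI : I ≠ ⊤) [Module.Finite k (R ⧸ I)] :
    HasLeastNonzeroIdeal (R ⧸ I) ↔ ∃ f g, I = Ideal.span {f, g} := by
  have : Nontrivial (R ⧸ I) := Ideal.Quotient.nontrivial_iff.mpr hI
  have : IsLocalRing (R ⧸ I) := .of_surjective' (Ideal.Quotient.mk I) Ideal.Quotient.mk_surjective
  obtain ⟨h1, h2⟩ := finite_and_finrank_quotient_maximalIdeal_mul k hres hm hdim I
  rw [hasLeastNonzeroIdeal_iff_finrank_ker_koszulMap k hres hm]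
  constructor
  · intro h
    exact exists_eq_span_pair_of_finrank_eq k (by omega)
  · rintro ⟨f, g, rfl⟩
    have h3 := finrank_quotient_maximalIdeal_mul_le k hres f g
    have : IsArtinianRing (R ⧸ Ideal.span {f, g}) := IsArtinianRing.of_finite k _
    obtain ⟨s, hs, hs'⟩ := exists_mem_ne_zero_and_mul_eq_zero (one_ne_zero (α := R ⧸ Ideal.span {f, g}))
    -- Two generators only bound the socle dimension above by one; the socle is nonzero since R/I is
    -- Artinian and nontrivial.
    have h4 : 0 < Module.finrank k (LinearMap.ker (koszulMap k (Ideal.span {f, g}) z₁ z₂)) := by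
      rw [Module.finrank_pos_iff_exists_ne_zero]
      refine ⟨⟨1 * s, mem_ker_koszulMap k |>.mpr ⟨hs' _ ?_, hs' _ ?_⟩⟩, fun h ↦ hs congr(($h).1)⟩ <;>
      exact mk_mem_maximalIdeal_iff.mpr (hm ▸ Ideal.subset_span (by simp))
    omega

include hres hm hdim in
/-- The bound on the length of a Gorenstein quotient in terms of its nilpotency order. -/
theorem HasLeastNonzeroIdeal.finrank_quotient_le {I : Ideal R} [Module.Finite k (R ⧸ I)]
    (h : HasLeastNonzeroIdeal (R ⧸ I)) {n : ℕ} (hn : maximalIdeal R ^ (n + 1) ≤ I) :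
    Module.finrank k (R ⧸ I) ≤ (n + 2) ^ 2 / 4 := by
  have key (i : ℕ) : 2 * Module.finrank k
      ((R ⧸ I) ⧸ (maximalIdeal R ^ i).map (Ideal.Quotient.mk I)) ≤ i * (i + 1) := by
    obtain ⟨h1, h2⟩ := finite_and_finrank_quotient_maximalIdeal_pow k hres hm hdim i
    refine le_trans (Nat.mul_le_mul_left 2 ?_) h2
    let f : (R ⧸ maximalIdeal R ^ i) →ₐ[k]
        (R ⧸ I) ⧸ (maximalIdeal R ^ i).map (Ideal.Quotient.mk I) :=
      Ideal.quotientMapₐ _ (Ideal.Quotient.mkₐ k I) Ideal.le_comap_map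
    exact LinearMap.finrank_le_finrank_of_surjective (f := f.toLinearMap)
      (Ideal.quotientMap_surjective (H := Ideal.le_comap_map) Ideal.Quotient.mk_surjective)
  have hprod (i j : ℕ) (hij : i + j = n + 1) :
      ∀ b ∈ (maximalIdeal R ^ i).map (Ideal.Quotient.mk I),
      ∀ c ∈ (maximalIdeal R ^ j).map (Ideal.Quotient.mk I), b * c = 0 := by
    intro b hb c hc
    have := Ideal.mul_mem_mul hb hc
    rw [← Ideal.map_mul, ← pow_add, hij] at this
    have h0 := Ideal.map_mono (f := Ideal.Quotient.mk I) hn this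
    rwa [Ideal.map_quotient_self, Ideal.mem_bot] at h0
  rw [Nat.le_div_iff_mul_le (by norm_num)]
  -- The most balanced splittings of n + 1 give (m+1)² for n = 2m and (m+1)(m+2) for n = 2m + 1.
  obtain ⟨m, rfl | rfl⟩ := Nat.even_or_odd' n
  · have h1 := h.finrank_le (k := k) (hprod m (m + 1) (by ring))
    have h2 := key m
    have h3 := key (m + 1)
    nlinarith
  · have h1 := h.finrank_le (k := k) (hprod (m + 1) (m + 1) (by ring))
    have h3 := key (m + 1)
    nlinarith

end Koszul

/-- The sum of two ideals to the power `a + b - 1` is contained in the sum of their powers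
of exponents `a` and `b`. -/
theorem sup_pow_le_pow_sup_pow {R : Type*} [CommRing R] (I J : Ideal R) {a b n : ℕ}
    (h : a + b ≤ n + 1) : (I ⊔ J) ^ n ≤ I ^ a ⊔ J ^ b := by
  rw [← Ideal.add_eq_sup, ← Ideal.add_eq_sup, add_pow, Ideal.sum_eq_sup]
  refine Finset.sup_le fun i hi ↦ ?_
  refine Ideal.mul_le_left.trans ?_
  by_cases hia : a ≤ i
  · exact (Ideal.mul_le_left.trans (Ideal.pow_le_pow_right hia)).trans le_sup_left
  · exact (Ideal.mul_le_right.trans (Ideal.pow_le_pow_right (by omega))).trans le_sup_right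

/-! ### The local ring as an algebra over the base field -/

section Stalk

variable {k : Type u} [Field k] {X : Scheme.{u}} (p : X ⟶ Spec (.of k)) (x : X)

/-- The structure map of the local ring of a scheme over a field. -/
noncomputable def stalkStructureMap : CommRingCat.of k ⟶ X.presheaf.stalk x :=
  (Scheme.ΓSpecIso (.of k)).inv ≫ p.appTop ≫ X.presheaf.germ ⊤ x trivial

theorem SpecMap_stalkStructureMap :
    Spec.map (stalkStructureMap p x) = X.fromSpecStalk x ≫ p := by
  rw [stalkStructureMap, Spec.map_comp, Spec.map_comp, ← Scheme.fromSpecStalk_toSpecΓ,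
    Category.assoc, Category.assoc, ← Scheme.toSpecΓ_naturality_assoc, ← SpecMap_ΓSpecIso_hom,
    ← Spec.map_comp]
  simp

/-- At a closed point of a scheme locally of finite type over an algebraically closed field `k`,
the residue field is `k`. -/
theorem exists_sub_stalkStructureMap_mem_maximalIdeal [IsAlgClosed k] [LocallyOfFiniteType p]
    (hx : IsClosed {x}) (r : X.presheaf.stalk x) :
    ∃ c : k, r - (stalkStructureMap p x).hom c ∈ maximalIdeal (X.presheaf.stalk x) := by
  -- The map from k to the residue field is the isomorphism provided by the Nullstellensatz at a
  -- closed point.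
  have h : stalkStructureMap p x ≫ X.residue x = (residueFieldIsoBase p x hx).inv := by
    apply Spec.map_injective
    rw [Spec.map_comp, SpecMap_stalkStructureMap, SpecMap_residueFieldIsoBase_inv,
      Scheme.fromSpecResidueField, Category.assoc]
  obtain ⟨c, hc⟩ := (ConcreteCategory.bijective_of_isIso (residueFieldIsoBase p x hx).inv).2
    (X.residue x r)
  refine ⟨c, ?_⟩
  rw [← IsLocalRing.residue_eq_zero_iff, map_sub, sub_eq_zero]
  change X.residue x r = X.residue x (stalkStructureMap p x c)
  rw [← hc, ← h]
  rfl

end Stalk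

/-! ### One-point schemes -/

section OnePoint

variable {Z : Scheme.{u}} [Subsingleton Z] (z : Z)

theorem opens_eq_top_of_mem {U : Z.Opens} (h : z ∈ U) : U = ⊤ := by
  ext w
  simpa [Subsingleton.elim w z] using h

theorem germ_top_bijective : Function.Bijective (Z.presheaf.germ ⊤ z trivial) := by
  constructor
  · intro s t hst
    obtain ⟨W, hW, i, j, h⟩ := Z.presheaf.germ_eq z _ _ s t hst
    obtain rfl := opens_eq_top_of_mem z hW
    obtain rfl : i = 𝟙 _ := Subsingleton.elim _ _
    obtain rfl : j = 𝟙 _ := Subsingleton.elim _ _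
    simpa using h
  · intro t
    obtain ⟨W, hW, s, h⟩ := Z.presheaf.exists_germ_eq t
    obtain rfl := opens_eq_top_of_mem z hW
    exact ⟨s, h⟩

/-- The global sections of a one-point scheme are the local ring at that point. -/
noncomputable def globalSectionsEquivStalk : Γ(Z, ⊤) ≃+* Z.presheaf.stalk z :=
  RingEquiv.ofBijective (Z.presheaf.germ ⊤ z trivial).hom (germ_top_bijective z)

/-- A point of the basic open set of f would make the germ there, hence f itself, a unit. So that
set is empty, which on a compact scheme means nilpotency. -/
theorem isNilpotent_of_not_isUnit {f : Γ(Z, ⊤)} (hf : ¬ IsUnit f) : IsNilpotent f := by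
  have : CompactSpace Z := Finite.compactSpace
  rw [Scheme.isNilpotent_iff_basicOpen_eq_bot]
  ext w
  simp only [TopologicalSpace.Opens.coe_bot, Set.mem_empty_iff_false, iff_false, SetLike.mem_coe]
  intro hw
  rw [Scheme.mem_basicOpen_top] at hw
  exact hf ((MulEquiv.isUnit_map (globalSectionsEquivStalk w)).mp hw)

end OnePoint

/-! ### Stalks of ideal sheaves as kernels -/

section ClosedSubscheme

variable {X : Scheme.{u}}

theorem germ_mem_iSup (I : X.IdealSheafData) {x : X} {U : X.affineOpens} (hx : x ∈ U.1)
    {a : Γ(X, U)} (ha : a ∈ I.ideal U) : X.presheaf.germ U.1 x hx a ∈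
      ⨆ (U : X.affineOpens) (hx : x ∈ U.1), (I.ideal U).map (X.presheaf.germ U.1 x hx).hom := by
  have h : (I.ideal U).map (X.presheaf.germ U.1 x hx).hom ≤
      ⨆ (U : X.affineOpens) (hx : x ∈ U.1), (I.ideal U).map (X.presheaf.germ U.1 x hx).hom :=
    le_iSup₂_of_le U hx le_rfl
  exact h (Ideal.mem_map_of_mem (X.presheaf.germ U.1 x hx).hom ha)

/-- The kernel of the map on stalks of a closed immersion with one-point source is the stalk
of the ideal sheaf. -/
theorem ker_stalkMap_subschemeι (I : X.IdealSheafData) [Subsingleton I.subscheme]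
    (z : I.subscheme) :
    RingHom.ker (I.subschemeι.stalkMap z).hom =
      ⨆ (U : X.affineOpens) (hx : I.subschemeι z ∈ U.1),
        (I.ideal U).map (X.presheaf.germ U.1 (I.subschemeι z) hx).hom := by
  apply le_antisymm
  · intro r hr
    obtain ⟨U, hzU, hU, a, rfl⟩ := TopCat.Presheaf.exists_mem_germ_eq_of_isBasis X.isBasis_affineOpens X.presheaf _ r
    have hzU' : z ∈ I.subschemeι ⁻¹ᵁ U := hzU
    have hr' : I.subscheme.presheaf.germ (I.subschemeι ⁻¹ᵁ U) z hzU (I.subschemeι.app U a) = 0 := by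
      rw [← Scheme.Hom.germ_stalkMap_apply]
      exact hr
    -- The preimage of U is the whole one-point scheme, so a section with zero germ is zero.
    have ha : a ∈ I.ideal ⟨U, hU⟩ := by
      rw [← Scheme.IdealSheafData.ker_subschemeι_app, RingHom.mem_ker]
      obtain ⟨W, hW, i, j, h⟩ := I.subscheme.presheaf.germ_eq z hzU' hzU' (I.subschemeι.app U a) 0
        (by rw [hr', map_zero])
      have hWtop := opens_eq_top_of_mem z hW
      have hUtop := opens_eq_top_of_mem z (U := I.subschemeι ⁻¹ᵁ U) hzU
      have : IsIso i := by
        obtain rfl : W = I.subschemeι ⁻¹ᵁ U := hWtop.trans hUtop.symm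
        obtain rfl : i = 𝟙 _ := Subsingleton.elim _ _
        infer_instance
      rw [map_zero, ← map_zero (I.subscheme.presheaf.map i.op).hom] at h
      exact (ConcreteCategory.bijective_of_isIso (I.subscheme.presheaf.map i.op)).1 h
    exact germ_mem_iSup I (U := ⟨U, hU⟩) hzU ha
  · refine iSup_le fun U ↦ iSup_le fun hz ↦ Ideal.map_le_iff_le_comap.mpr fun a ha ↦ ?_
    rw [← I.ker_subschemeι_app, RingHom.mem_ker] at ha
    change I.subschemeι.stalkMap z (X.presheaf.germ U.1 _ hz a) = 0
    rw [Scheme.Hom.germ_stalkMap_apply]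
    refine (congrArg _ ha).trans (map_zero _)

theorem presheaf_map_injective_of_eq_top {Z : Scheme.{u}} {V : Z.Opens} (hV : V = ⊤) (i : V ⟶ ⊤) :
    Function.Injective (Z.presheaf.map i.op) := by
  subst hV
  obtain rfl : i = 𝟙 _ := Subsingleton.elim _ _
  intro a b h
  simpa using h

end ClosedSubscheme

/-! ### Global functions on a cluster -/

namespace ClusterAt

variable {k : Type u} [Field k] {X : Scheme.{u}} {x : X} (ζ : ClusterAt X x)

theorem exists_ι_eq : ∃ z, ζ.ι z = x := by
  have h : x ∈ Set.range ζ.idealSheaf.subschemeι := by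
    rw [Scheme.IdealSheafData.range_subschemeι, ζ.support_eq]; rfl
  exact h

instance subsingleton_toScheme : Subsingleton ζ.toScheme := by
  refine ⟨fun z w ↦ ζ.idealSheaf.subschemeι.isClosedEmbedding.injective ?_⟩
  have h (z : ζ.toScheme) : ζ.idealSheaf.subschemeι z = x := by
    have : ζ.idealSheaf.subschemeι z ∈ Set.range ζ.idealSheaf.subschemeι := ⟨z, rfl⟩
    rw [Scheme.IdealSheafData.range_subschemeι, ζ.support_eq] at this
    exact this
  rw [h, h]

/-- The global functions on a cluster are the quotient of the local ring of the ambient scheme by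
the ideal of the cluster. -/
theorem exists_ringHom (p : X ⟶ Spec (.of k)) : ∃ φ : X.presheaf.stalk x →+* Γ(ζ.toScheme, ⊤),
    Function.Surjective φ ∧ RingHom.ker φ = ζ.ideal ∧
      φ.comp (stalkStructureMap p x).hom =
        ((Scheme.ΓSpecIso (.of k)).inv ≫ (ζ.ι ≫ p).appTop).hom := by
  have hsub := ζ.subsingleton_toScheme
  obtain ⟨z, hz⟩ := ζ.exists_ι_eq
  -- Unfolding the cluster lets `x` be replaced by the image of `z`, so that the stalk map starts at
  -- the local ring in question.
  obtain ⟨I, hI⟩ := ζ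
  change I.subscheme at z
  change Subsingleton I.subscheme at hsub
  change I.subschemeι z = x at hz
  subst hz
  let e := globalSectionsEquivStalk z
  refine ⟨e.symm.toRingHom.comp (I.subschemeι.stalkMap z).hom, ?_, ?_, ?_⟩
  · exact e.symm.surjective.comp (I.subschemeι.stalkMap_surjective z)
  · refine Eq.trans ?_ (ker_stalkMap_subschemeι I z)
    ext r
    exact map_eq_zero_iff e.symm e.symm.injective
  · ext c
    refine (RingEquiv.symm_apply_eq e).mpr ?_
    change I.subschemeι.stalkMap z (X.presheaf.germ ⊤ (I.subschemeι z) trivial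
      (p.appTop ((Scheme.ΓSpecIso (.of k)).inv c))) = _
    exact (Scheme.Hom.germ_stalkMap_apply I.subschemeι ⊤ z trivial _).trans rfl

theorem isGorenstein_iff : ζ.IsGorenstein ↔ IsGorensteinLocalRing Γ(ζ.toScheme, ⊤) := by
  obtain ⟨z, -⟩ := ζ.exists_ι_eq
  constructor
  · exact fun h ↦ (h z).of_ringEquiv (globalSectionsEquivStalk z).symm
  · exact fun h w ↦ h.of_ringEquiv (globalSectionsEquivStalk w)

instance nontrivial_globalSections : Nontrivial Γ(ζ.toScheme, ⊤) := by
  obtain ⟨z, -⟩ := ζ.exists_ι_eq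
  exact (globalSectionsEquivStalk z).nontrivial

end ClusterAt

/-! ### Clusters with prescribed ideal -/

section Existence

variable {X : Scheme.{u}} {x : X}

theorem subsingleton_primeSpectrum_quotient {R : Type u} [CommRing R] [IsLocalRing R] {J : Ideal R}
    {N : ℕ} (hN : maximalIdeal R ^ N ≤ J) : Subsingleton (PrimeSpectrum (R ⧸ J)) := by
  have h (q : PrimeSpectrum (R ⧸ J)) :
      q.asIdeal.comap (Ideal.Quotient.mk J) = maximalIdeal R := by
    have hq : (q.asIdeal.comap (Ideal.Quotient.mk J)).IsPrime := inferInstance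
    refine le_antisymm (le_maximalIdeal hq.ne_top) (hq.le_of_pow_le (n := N) (hN.trans fun r hr ↦ ?_))
    rw [Ideal.mem_comap, Ideal.Quotient.eq_zero_iff_mem.mpr hr]
    exact zero_mem _
  refine ⟨fun q q' ↦ PrimeSpectrum.ext ?_⟩
  exact Ideal.comap_injective_of_surjective _ Ideal.Quotient.mk_surjective ((h q).trans (h q').symm)

theorem SpecMap_fromSpecStalk_app {S : CommRingCat.{u}} (φ : X.presheaf.stalk x ⟶ S) {U : X.Opens}
    (hxU : x ∈ U) : (Spec.map φ ≫ X.fromSpecStalk x).app U = X.presheaf.germ U x hxU ≫ φ ≫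
      (Scheme.ΓSpecIso S).inv ≫
        (Spec S).presheaf.map (homOfLE (le_top : (Spec.map φ ≫ X.fromSpecStalk x) ⁻¹ᵁ U ≤ ⊤)).op := by
  rw [Scheme.ΓSpecIso_inv_naturality_assoc, Scheme.Hom.comp_app, Scheme.fromSpecStalk_app hxU]
  simp only [Category.assoc]
  congr 2

/-- The projection of the local ring of `X` at `x` to its quotient by `J`. -/
noncomputable def stalkQuotientHom (J : Ideal (X.presheaf.stalk x)) :
    X.presheaf.stalk x ⟶ CommRingCat.of (X.presheaf.stalk x ⧸ J) :=
  CommRingCat.ofHom (Ideal.Quotient.mk J)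

/-- The inclusion of the closed subscheme of `Spec 𝒪_{X, x}` defined by an ideal. -/
noncomputable def fromSpecStalkQuotient (J : Ideal (X.presheaf.stalk x)) :
    Spec (.of (X.presheaf.stalk x ⧸ J)) ⟶ X :=
  Spec.map (stalkQuotientHom J) ≫ X.fromSpecStalk x

variable {J : Ideal (X.presheaf.stalk x)} {N : ℕ} (hJ : J ≠ ⊤)
  (hN : maximalIdeal (X.presheaf.stalk x) ^ N ≤ J)

include hJ in
theorem fromSpecStalkQuotient_apply [Subsingleton (PrimeSpectrum (X.presheaf.stalk x ⧸ J))]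
    (y : Spec (.of (X.presheaf.stalk x ⧸ J))) : fromSpecStalkQuotient J y = x := by
  have : Nontrivial (X.presheaf.stalk x ⧸ J) := Ideal.Quotient.nontrivial_iff.mpr hJ
  have : IsLocalRing (X.presheaf.stalk x ⧸ J) :=
    .of_surjective' (Ideal.Quotient.mk J) Ideal.Quotient.mk_surjective
  have hloc := IsLocalHom.of_surjective (Ideal.Quotient.mk J) Ideal.Quotient.mk_surjective
  obtain rfl : y = closedPoint (X.presheaf.stalk x ⧸ J) := Subsingleton.elim (α := PrimeSpectrum _) _ _
  have : Spec.map (stalkQuotientHom J) (closedPoint (X.presheaf.stalk x ⧸ J)) =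
      closedPoint (X.presheaf.stalk x) := IsLocalRing.comap_closedPoint (Ideal.Quotient.mk J)
  exact (congrArg (X.fromSpecStalk x) this).trans Scheme.fromSpecStalk_closedPoint

/-- When the preimage of U is everything, restriction from global sections is injective, so
vanishing can be tested in the quotient ring. -/
theorem fromSpecStalkQuotient_app_eq_zero_iff {U : X.Opens} (hxU : x ∈ U)
    (hU : fromSpecStalkQuotient J ⁻¹ᵁ U = ⊤) (a : Γ(X, U)) :
    (fromSpecStalkQuotient J).app U a = 0 ↔ X.presheaf.germ U x hxU a ∈ J := by
  have hinj := presheaf_map_injective_of_eq_top hU (homOfLE le_top)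
  have h : (fromSpecStalkQuotient J).app U a = (Spec (.of (X.presheaf.stalk x ⧸ J))).presheaf.map
      (homOfLE (le_top : fromSpecStalkQuotient J ⁻¹ᵁ U ≤ ⊤)).op
      ((Scheme.ΓSpecIso (.of (X.presheaf.stalk x ⧸ J))).inv
        (stalkQuotientHom J (X.presheaf.germ U x hxU a))) :=
    congr(($(SpecMap_fromSpecStalk_app (stalkQuotientHom J) hxU)).hom a)
  rw [h, map_eq_zero_iff _ hinj, map_eq_zero_iff _ (ConcreteCategory.bijective_of_isIso
    (Scheme.ΓSpecIso (.of (X.presheaf.stalk x ⧸ J))).inv).1]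
  exact Ideal.Quotient.eq_zero_iff_mem

include hJ hN in
/-- Every primary ideal of the local ring at a closed point is the ideal of a cluster. -/
theorem exists_clusterAt_ideal_eq (hx : IsClosed {x}) : ∃ ζ : ClusterAt X x, ζ.ideal = J := by
  have hsub := subsingleton_primeSpectrum_quotient hN
  have hfin : Finite (Spec (.of (X.presheaf.stalk x ⧸ J))) :=
    inferInstanceAs (Finite (PrimeSpectrum (X.presheaf.stalk x ⧸ J)))
  have happ := fromSpecStalkQuotient_apply hJ
  have hqc : QuasiCompact (fromSpecStalkQuotient J) := ⟨fun _ _ _ ↦ (Set.toFinite _).isCompact⟩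
  have : Nontrivial (X.presheaf.stalk x ⧸ J) := Ideal.Quotient.nontrivial_iff.mpr hJ
  have hne : Nonempty (Spec (.of (X.presheaf.stalk x ⧸ J))) :=
    inferInstanceAs (Nonempty (PrimeSpectrum (X.presheaf.stalk x ⧸ J)))
  have hU (U : X.Opens) (hxU : x ∈ U) : fromSpecStalkQuotient J ⁻¹ᵁ U = ⊤ := by
    ext y
    simp [happ, hxU]
  have hrange : Set.range (fromSpecStalkQuotient J) = {x} := by
    rw [funext happ]
    exact Set.range_const
  have hker (U : X.affineOpens) : (fromSpecStalkQuotient J).ker.ideal U =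
      RingHom.ker ((fromSpecStalkQuotient J).app U).hom := Scheme.Hom.ker_apply _ U
  -- The cluster is the scheme-theoretic image of the spectrum of the quotient by J; its support is
  -- the closure of {x}.
  refine ⟨⟨(fromSpecStalkQuotient J).ker, ?_⟩, ?_⟩
  · rw [Scheme.Hom.support_ker, hrange]
    exact hx.closure_eq
  · apply le_antisymm
    · refine iSup_le fun U ↦ iSup_le fun hxU ↦ Ideal.map_le_iff_le_comap.mpr fun a ha ↦ ?_
      rw [hker] at ha
      exact (fromSpecStalkQuotient_app_eq_zero_iff hxU (hU _ hxU) a).mp ha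
    · intro r hr
      obtain ⟨U, hxU, hUa, a, rfl⟩ := TopCat.Presheaf.exists_mem_germ_eq_of_isBasis X.isBasis_affineOpens X.presheaf _ r
      refine germ_mem_iSup _ (U := ⟨U, hUa⟩) hxU ?_
      change a ∈ (fromSpecStalkQuotient J).ker.ideal ⟨U, hUa⟩
      rw [hker]
      exact (fromSpecStalkQuotient_app_eq_zero_iff hxU (hU _ hxU) a).mpr hr

end Existence

/-- Regularity says that the minimal number of generators of the maximal ideal is the dimension. -/
theorem exists_maximalIdeal_eq_span_pair {R : Type*} [CommRing R] [IsRegularLocalRing R]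
    (hdim : ringKrullDim R = 2) : ∃ z₁ z₂ : R, maximalIdeal R = Ideal.span {z₁, z₂} := by
  have h := IsRegularLocalRing.spanFinrank_maximalIdeal (R := R)
  rw [hdim] at h
  obtain ⟨s, hs, hs'⟩ := Submodule.FG.exists_span_finset_card_eq_spanFinrank
    (IsNoetherian.noetherian (maximalIdeal R))
  rw [show (maximalIdeal R).spanFinrank = 2 by exact_mod_cast h] at hs
  classical
  obtain ⟨z₁, z₂, -, rfl⟩ := Finset.card_eq_two.mp hs
  exact ⟨z₁, z₂, by rw [← hs']; simp [Ideal.span]⟩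

/-! ### Degree and Gorenstein property read off from the ideal -/

namespace ClusterAt

variable {k : Type u} [Field k] {X : Scheme.{u}} {x : X} (ζ : ClusterAt X x)
  (p : X ⟶ Spec (.of k))

theorem ideal_ne_top (p : X ⟶ Spec (.of k)) : ζ.ideal ≠ ⊤ := by
  obtain ⟨φ, -, hφ, -⟩ := ζ.exists_ringHom p
  rw [← hφ]
  exact RingHom.ker_ne_top φ

/-- The ideal of a cluster contains a power of each element of the maximal ideal. -/
theorem exists_pow_mem_ideal (p : X ⟶ Spec (.of k)) {r : X.presheaf.stalk x}
    (hr : r ∈ maximalIdeal (X.presheaf.stalk x)) : ∃ n, r ^ n ∈ ζ.ideal := by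
  obtain ⟨φ, hφs, hφ, -⟩ := ζ.exists_ringHom p
  have := IsLocalHom.of_surjective φ hφs
  have hu : ¬ IsUnit (φ r) := fun h ↦ (mem_maximalIdeal r).mp hr (isUnit_of_map_unit φ r h)
  obtain ⟨n, hn⟩ := isNilpotent_of_not_isUnit hu
  refine ⟨n, ?_⟩
  rw [← hφ, RingHom.mem_ker, map_pow, hn]

/-- The global functions on a cluster as a quotient of the local ring, over the base field. -/
theorem exists_ringEquiv [Algebra k (X.presheaf.stalk x)]
    (halg : algebraMap k (X.presheaf.stalk x) = (stalkStructureMap p x).hom) :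
    ∃ e : (X.presheaf.stalk x ⧸ ζ.ideal) ≃+* Γ(ζ.toScheme, ⊤),
      ∀ c : k, e (algebraMap k _ c) =
        ((Scheme.ΓSpecIso (.of k)).inv ≫ (ζ.ι ≫ p).appTop).hom c := by
  obtain ⟨φ, hφs, hφ, hc⟩ := ζ.exists_ringHom p
  refine ⟨(Ideal.quotEquivOfEq hφ.symm).trans (RingHom.quotientKerEquivOfSurjective hφs),
    fun c ↦ ?_⟩
  rw [← hc, ← halg]
  rfl

theorem degree_eq_finrank [Algebra k (X.presheaf.stalk x)]
    (halg : algebraMap k (X.presheaf.stalk x) = (stalkStructureMap p x).hom) :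
    ζ.degree p = Module.finrank k (X.presheaf.stalk x ⧸ ζ.ideal) := by
  obtain ⟨e, he⟩ := ζ.exists_ringEquiv p halg
  let _ : Algebra k Γ(ζ.toScheme, ⊤) :=
    ((Scheme.ΓSpecIso (.of k)).inv ≫ (ζ.ι ≫ p).appTop).hom.toAlgebra
  exact (AlgEquiv.ofRingEquiv (f := e) he).toLinearEquiv.finrank_eq.symm

theorem isGorenstein_iff_quotient (p : X ⟶ Spec (.of k)) :
    ζ.IsGorenstein ↔ IsGorensteinLocalRing (X.presheaf.stalk x ⧸ ζ.ideal) := by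
  obtain ⟨φ, hφs, hφ, -⟩ := ζ.exists_ringHom p
  let e : (X.presheaf.stalk x ⧸ ζ.ideal) ≃+* Γ(ζ.toScheme, ⊤) :=
    (Ideal.quotEquivOfEq hφ.symm).trans (RingHom.quotientKerEquivOfSurjective hφs)
  rw [ζ.isGorenstein_iff]
  exact ⟨fun h ↦ h.of_ringEquiv e.symm, fun h ↦ h.of_ringEquiv e⟩

end ClusterAt
-- The theorem
theorem theorem2p1 {k : Type u} [Field k] [IsAlgClosed k] {X : Scheme.{u}}
    (p : X ⟶ Spec (.of k)) [LocallyOfFiniteType p] (x : X) (hx : IsSmoothSurfacePoint X x) :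
    -- for clusters supported at `x`, Gorenstein and complete intersection mean the same
    (∀ ζ : ClusterAt X x, ζ.IsGorenstein ↔ ζ.IsCompleteIntersection) ∧
    -- the maximal degree
    (∀ n : ℕ, IsGreatest
      {d : ℕ | ∃ ζ : ClusterAt X x,
        ζ.IsGorenstein ∧ maximalIdeal (X.presheaf.stalk x) ^ (n + 1) ≤ ζ.ideal ∧ ζ.degree p = d}
      ((n + 2) ^ 2 / 4)) ∧
    -- the clusters attaining it, for local parameters `z₁`, `z₂` at `x`
    (∀ z₁ z₂ : X.presheaf.stalk x, maximalIdeal (X.presheaf.stalk x) = Ideal.span {z₁, z₂} →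
      ∀ n m a : ℕ, (n = 2 * m ∧ a = m + 1) ∨ (n + 1 = 2 * m ∧ a = m) →
        (∃ ζ : ClusterAt X x, ζ.ideal = Ideal.span {z₁ ^ a, z₂ ^ (m + 1)}) ∧
        ∀ ζ : ClusterAt X x, ζ.ideal = Ideal.span {z₁ ^ a, z₂ ^ (m + 1)} →
          ζ.IsGorenstein ∧ maximalIdeal (X.presheaf.stalk x) ^ (n + 1) ≤ ζ.ideal ∧
            ζ.degree p = (n + 2) ^ 2 / 4) := by
  have hreg := hx.isRegularLocalRing
  have hdim := hx.ringKrullDim_eq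
  let _ : Algebra k (X.presheaf.stalk x) := (stalkStructureMap p x).hom.toAlgebra
  have halg : algebraMap k (X.presheaf.stalk x) = (stalkStructureMap p x).hom := rfl
  have hres : ∀ r : X.presheaf.stalk x, ∃ c : k,
      r - algebraMap k (X.presheaf.stalk x) c ∈ maximalIdeal (X.presheaf.stalk x) :=
    exists_sub_stalkStructureMap_mem_maximalIdeal p x hx.isClosed
  obtain ⟨y₁, y₂, hy⟩ := exists_maximalIdeal_eq_span_pair hdim
  have hfin (ζ : ClusterAt X x) : Module.Finite k (X.presheaf.stalk x ⧸ ζ.ideal) := by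
    -- The ideal contains powers of both parameters, hence an ideal of known finite colength.
    obtain ⟨a, ha⟩ := ζ.exists_pow_mem_ideal p (r := y₁) (hy ▸ Ideal.subset_span (by simp))
    obtain ⟨b, hb⟩ := ζ.exists_pow_mem_ideal p (r := y₂) (hy ▸ Ideal.subset_span (by simp))
    have := (finite_and_finrank_quotient_span_pow_pow k hres hy hdim a b).1
    refine finite_quotient_of_le k (I := Ideal.span {y₁ ^ a, y₂ ^ b}) ?_
    rw [Ideal.span_le]
    rintro _ (rfl | rfl) <;> assumption
  have hsocle (ζ : ClusterAt X x) :
      ζ.IsGorenstein ↔ HasLeastNonzeroIdeal (X.presheaf.stalk x ⧸ ζ.ideal) := by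
    have := hfin ζ
    have : Nontrivial (X.presheaf.stalk x ⧸ ζ.ideal) :=
      Ideal.Quotient.nontrivial_iff.mpr (ζ.ideal_ne_top p)
    have : IsLocalRing (X.presheaf.stalk x ⧸ ζ.ideal) :=
      .of_surjective' (Ideal.Quotient.mk ζ.ideal) Ideal.Quotient.mk_surjective
    rw [ζ.isGorenstein_iff_quotient p, isGorensteinLocalRing_iff k]
  have hci (ζ : ClusterAt X x) : ζ.IsGorenstein ↔ ζ.IsCompleteIntersection := by
    have := hfin ζ
    rw [hsocle, hasLeastNonzeroIdeal_quotient_iff k hres hy hdim (ζ.ideal_ne_top p)]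
    rfl
  have hmax (z₁ z₂ : X.presheaf.stalk x)
      (hz : maximalIdeal (X.presheaf.stalk x) = Ideal.span {z₁, z₂}) (n m a : ℕ)
      (hnma : (n = 2 * m ∧ a = m + 1) ∨ (n + 1 = 2 * m ∧ a = m)) :
      (∃ ζ : ClusterAt X x, ζ.ideal = Ideal.span {z₁ ^ a, z₂ ^ (m + 1)}) ∧
        ∀ ζ : ClusterAt X x, ζ.ideal = Ideal.span {z₁ ^ a, z₂ ^ (m + 1)} →
          ζ.IsGorenstein ∧ maximalIdeal (X.presheaf.stalk x) ^ (n + 1) ≤ ζ.ideal ∧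
            ζ.degree p = (n + 2) ^ 2 / 4 := by
    have hpow : maximalIdeal (X.presheaf.stalk x) ^ (n + 1) ≤
        Ideal.span {z₁ ^ a, z₂ ^ (m + 1)} := by
      rw [hz, Ideal.span_insert, Ideal.span_insert, ← Ideal.span_singleton_pow,
        ← Ideal.span_singleton_pow]
      -- In both parities a + (m + 1) = n + 2.
      exact sup_pow_le_pow_sup_pow _ _ (by omega)
    have hle : Ideal.span {z₁ ^ a, z₂ ^ (m + 1)} ≤ maximalIdeal (X.presheaf.stalk x) := by
      rw [Ideal.span_le]
      rintro _ (rfl | rfl)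
      · exact Ideal.pow_mem_of_mem _ (hz ▸ Ideal.subset_span (by simp)) _ (by omega)
      · exact Ideal.pow_mem_of_mem _ (hz ▸ Ideal.subset_span (by simp)) _ (by omega)
    refine ⟨exists_clusterAt_ideal_eq
      (fun h ↦ (maximalIdeal.isMaximal _).ne_top (top_le_iff.mp (h ▸ hle))) hpow hx.isClosed,
      fun ζ hζ ↦ ⟨(hci ζ).mpr ⟨_, _, hζ⟩, hζ ▸ hpow, ?_⟩⟩
    rw [ζ.degree_eq_finrank p halg, hζ,
      (finite_and_finrank_quotient_span_pow_pow k hres hz hdim a (m + 1)).2, eq_comm]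
    -- For even n the square is divisible by 4; for odd n it leaves remainder 1, which the floor
    -- discards.
    rcases hnma with ⟨rfl, rfl⟩ | ⟨h, rfl⟩
    · rw [show (2 * m + 2) ^ 2 = 4 * ((m + 1) * (m + 1)) by ring, Nat.mul_div_cancel_left _ (by simp)]
    · rw [show n + 2 = 2 * a + 1 by omega, show (2 * a + 1) ^ 2 = 1 + 4 * (a * (a + 1)) by ring,
        Nat.add_mul_div_left _ _ (by simp)]
      simp
  refine ⟨hci, fun n ↦ ⟨?_, ?_⟩, hmax⟩
  · obtain ⟨m, a, h⟩ : ∃ m a, (n = 2 * m ∧ a = m + 1) ∨ (n + 1 = 2 * m ∧ a = m) := by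
      obtain ⟨m, rfl | rfl⟩ := Nat.even_or_odd' n
      · exact ⟨m, m + 1, by omega⟩
      -- Here n = 2m + 1 = 2(m + 1) - 1, so the parameter shifts by one.
      · exact ⟨m + 1, m + 1, by omega⟩
    obtain ⟨⟨ζ, hζ⟩, h'⟩ := hmax y₁ y₂ hy n m a h
    exact ⟨ζ, h' ζ hζ⟩
  · rintro _ ⟨ζ, hG, hn, rfl⟩
    have := hfin ζ
    rw [ζ.degree_eq_finrank p halg]
    exact ((hsocle ζ).mp hG).finrank_quotient_le k hres hy hdim hn
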